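/- Conventions. Let $\mathcal A$ be an abelian category and $\mathcal W$ a full additive subcategory closed under isomorphisms. A $\mathcal W$-resolution of $M$ is a complex $W=(\cdots\to W_1\to W_0)$ of objects of $\mathcal W$ with an augmentation $W_0\to M$ such that $\cdots\to W_1\to W_0\to M\to 0$ is exact; it is proper if this augmented complex stays exact under $\operatorname{Hom}_{\mathcal A}(V,-)$ for every $V\in\mathcal W$. Put $\mathcal W\text{-}\mathrm{pd}(M)=\inf_W\sup\{n\ge 0: W_n\neq 0\}$, the infimum over all $\mathcal W$-resolutions $W$ of $M$. A complex $T=(T_n)_{n\in\mathbb Z}$ of objects of $\mathcal W$ is totally $\mathcal W$-acyclic if it is exact and stays exact under $\operatorname{Hom}_{\mathcal A}(V,-)$ and $\operatorname{Hom}_{\mathcal A}(-,V)$ for every $V\in\mathcal W$; $\mathcal G(\mathcal W)$ is the subcategory of objects isomorphic to $\operatorname{Coker}(T_1\to T_0)$ for such $T$. A Tate $\mathcal W$-resolution of $M$ is a diagram $T\xrightarrow{\alpha}W\to M$ with $T$ totally $\mathcal W$-acyclic, $W\to M$ a proper $\mathcal W$-resolution, and $\alpha$ a morphism of complexes with $\alpha_n$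 an isomorphism for $n\gg 0$. If $M$ has one, set $\widehat{\operatorname{Ext}}{}^n_{\mathcal W}(M,N)=H_{-n}(\operatorname{Hom}_{\mathcal A}(T,N))$ for $n\in\mathbb Z$ and $N\in\mathcal A$; up to isomorphism this does not depend on the choice. $\widehat{\operatorname{Ext}}{}^n_{\mathcal W}(M,-)=0$ means vanishing on all objects of $\mathcal A$, and $\widehat{\operatorname{Ext}}{}^n_{\mathcal W}(-,M)=0$ means vanishing on all objects that admit a Tate $\mathcal W$-resolution. An $R$-module $C$ over a commutative ring $R$ is semidualizing if it has a (possibly infinite) resolution by free modules of finite rank, the homothety map $R\to\operatorname{Hom}_R(C,C)$ is an isomorphism, and $\operatorname{Ext}^n_R(C,C)=0$ for all $n\ge1$. $\mathcal P_C$ denotes the category of $R$-modules isomorphic to $P\otimes_R C$ with $P$ projective. **Theorem C.** Let $R$ be a commutative ring, $C$ a semidualizing $R$-module, and $M$ an $R$-module with $\mathcal G(\mathcal P_C)\text{-}\mathrm{pd}(M)<\infty$. Then $M$ admits a Tate $\mathcal P_C$-resolution, and the following conditions are equivalent: (i) $\mathcal P_C\text{-}\mathrm{pd}(M)<\infty$;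 (ii) $\widehat{\operatorname{Ext}}{}^n_{\mathcal P_C}(-,M)=0$ for each (equivalently, for some) $n\in\mathbb Z$; (iii) $\widehat{\operatorname{Ext}}{}^n_{\mathcal P_C}(M,-)=0$ for each (equivalently, for some) $n\in\mathbb Z$; (iv) $\widehat{\operatorname{Ext}}{}^0_{\mathcal P_C}(M,M)=0$. **General form.** Let $\mathcal A$ be an abelian category and $\mathcal W$ a full additive subcategory of $\mathcal A$ that is closed under direct summands, extensions and kernels of epimorphisms and satisfies $\operatorname{Ext}^n_{\mathcal A}(W,W')=0$ for all $n\ge1$ and all $W,W'\in\mathcal W$. Let $M\in\mathcal A$ satisfy $\mathcal G(\mathcal W)\text{-}\mathrm{pd}(M)<\infty$. Then $M$ admits a Tate $\mathcal W$-resolution, and the conditions (i)–(iv) with $\mathcal W$ in place of $\mathcal P_C$ are equivalent. -/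

import Mathlib

open CategoryTheory CategoryTheory.Limits CategoryTheory.Abelian Opposite
open scoped TensorProduct

universe w v u

namespace RelTate

section Abstract

variable {A : Type u} [Category.{v} A] [Abelian A]

/-- The complex `K` is `Hom(𝒳, -)`-exact: for every `X` in `𝒳` the complex of abelian groups
`Hom(X, K)` is exact. -/
def HomFromExact (𝒳 : ObjectProperty A) {ι : Type} {c : ComplexShape ι}
    (K : HomologicalComplex A c) : Prop :=
  ∀ X : A, 𝒳 X →
    (((preadditiveCoyoneda.obj (op X)).mapHomologicalComplex c).obj K).Acyclic

/-- The complex of abelian groups `Hom(K, N)`. If `K` is a homological complex indexed by `ℤ`,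
the group in degree `n` is `Hom(K_n, N)` and the differentials, given by precomposition with those
of `K`, raise `n`; in homological grading this group sits in degree `-n`. -/
noncomputable def homComplex {ι : Type} {c : ComplexShape ι} (K : HomologicalComplex A c) (N : A) :
    HomologicalComplex AddCommGrpCat.{v} c.symm :=
  ((preadditiveYoneda.obj N).mapHomologicalComplex c.symm).obj K.op

/-- The complex `K` is `Hom(-, 𝒳)`-exact: for every `X` in `𝒳` the complex of abelian groups
`Hom(K, X)` is exact. -/
def HomIntoExact (𝒳 : ObjectProperty A) {ι : Type} {c : ComplexShape ι}
    (K : HomologicalComplex A c) : Prop :=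
  ∀ X : A, 𝒳 X → (homComplex K X).Acyclic

/-- An `𝒳`-resolution of `M`: a complex `⋯ ⟶ X₁ ⟶ X₀` of objects of `𝒳` with an augmentation
`X₀ ⟶ M` such that the augmented complex `⋯ ⟶ X₁ ⟶ X₀ ⟶ M ⟶ 0` is exact. -/
structure Resolution (𝒳 : ObjectProperty A) (M : A) where
  /-- the complex of the resolution, concentrated in nonnegative degrees -/
  complex : ChainComplex A ℕ
  mem : ∀ n, 𝒳 (complex.X n)
  /-- the augmentation -/
  ε : complex.X 0 ⟶ M
  d_comp_ε : complex.d 1 0 ≫ ε = 0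
  exact : (complex.augment ε d_comp_ε).Acyclic

/-- The augmented complex `⋯ ⟶ X₁ ⟶ X₀ ⟶ M ⟶ 0`. -/
def Resolution.augmented {𝒳 : ObjectProperty A} {M : A} (X : Resolution 𝒳 M) : ChainComplex A ℕ :=
  X.complex.augment X.ε X.d_comp_ε

/-- An `𝒳`-resolution is proper if its augmented complex is `Hom(𝒳, -)`-exact. -/
def Resolution.IsProper {𝒳 : ObjectProperty A} {M : A} (X : Resolution 𝒳 M) : Prop :=
  HomFromExact 𝒳 X.augmented

/-- The length `sup {n ≥ 0 | X_n ≠ 0}` of an `𝒳`-resolution. -/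
noncomputable def Resolution.length {𝒳 : ObjectProperty A} {M : A} (X : Resolution 𝒳 M) : ℕ∞ :=
  ⨆ (n : ℕ) (_ : ¬ IsZero (X.complex.X n)), (n : ℕ∞)

/-- The `𝒳`-projective dimension of `M`: the infimum of the lengths of the `𝒳`-resolutions of `M`,
which is `⊤` if there is none. -/
noncomputable def projDim (𝒳 : ObjectProperty A) (M : A) : ℕ∞ :=
  ⨅ X : Resolution 𝒳 M, X.length

/-- `𝒳` is closed under kernels of epimorphisms. -/
def ClosedUnderKernelsOfEpis (𝒳 : ObjectProperty A) : Prop :=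
  ∀ S : ShortComplex A, S.ShortExact → 𝒳 S.X₂ → 𝒳 S.X₃ → 𝒳 S.X₁

/-- `𝒳 ⊥ 𝒴`: `Ext^n(X, Y) = 0` for all `n ≥ 1`, all `X` in `𝒳` and all `Y` in `𝒴`. -/
def Orthogonal [HasExt.{w} A] (𝒳 𝒴 : ObjectProperty A) : Prop :=
  ∀ X Y : A, 𝒳 X → 𝒴 Y → ∀ n : ℕ, 1 ≤ n → Subsingleton (Ext.{w} X Y n)

/-- Totally `𝒲`-acyclic complexes: exact complexes of objects of `𝒲` that are `Hom(𝒲, -)`-exact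
and `Hom(-, 𝒲)`-exact. -/
structure IsTotallyAcyclic (𝒲 : ObjectProperty A) (T : ChainComplex A ℤ) : Prop where
  mem : ∀ n, 𝒲 (T.X n)
  exact : T.Acyclic
  homFrom : HomFromExact 𝒲 T
  homInto : HomIntoExact 𝒲 T

/-- The subcategory `𝒢(𝒲)`: objects isomorphic to `Coker (T₁ ⟶ T₀)` for some totally
`𝒲`-acyclic complex `T`. -/
def gorenstein (𝒲 : ObjectProperty A) : ObjectProperty A := fun M =>
  ∃ T : ChainComplex A ℤ, IsTotallyAcyclic 𝒲 T ∧ Nonempty (M ≅ cokernel (T.d 1 0))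

/-- A Tate `𝒲`-resolution `T ⟶ W ⟶ M` of `M`: a totally `𝒲`-acyclic complex `T`, a proper
`𝒲`-resolution `W ⟶ M` and a morphism of complexes `α : T ⟶ W` with `α_n` an isomorphism for
`n ≫ 0`. As `W` is zero in negative degrees, `α` amounts to the maps `α_n`, `n ≥ 0`, and their
compatibility with the differentials between nonnegative degrees. -/
structure TateResolution (𝒲 : ObjectProperty A) (M : A) where
  /-- the totally acyclic complex -/
  T : ChainComplex A ℤ
  totallyAcyclic : IsTotallyAcyclic 𝒲 T
  /-- the proper resolution -/
  W : Resolution 𝒲 M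
  proper : W.IsProper
  /-- the comparison morphism `T ⟶ W` -/
  α (n : ℕ) : T.X (n : ℤ) ⟶ W.complex.X n
  comm (n : ℕ) :
    α (n + 1) ≫ W.complex.d (n + 1) n = T.d ((n + 1 : ℕ) : ℤ) (n : ℤ) ≫ α n
  eventually_isIso : ∃ N : ℕ, ∀ n : ℕ, N ≤ n → IsIso (α n)

/-- `M` admits a Tate `𝒲`-resolution. -/
class HasTateResolution (𝒲 : ObjectProperty A) (M : A) : Prop where
  nonempty : Nonempty (TateResolution 𝒲 M)

/-- A choice of a Tate `𝒲`-resolution of an object that admits one. -/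
noncomputable def tateResolution (𝒲 : ObjectProperty A) (M : A) [HasTateResolution 𝒲 M] :
    TateResolution 𝒲 M :=
  (HasTateResolution.nonempty (𝒲 := 𝒲) (M := M)).some

/-- The Tate cohomology group `Êxt^n_𝒲(M, N) = H_{-n}(Hom(T, N))`, for `n ∈ ℤ`, where
`T ⟶ W ⟶ M` is a Tate `𝒲`-resolution of `M` (any two choices give isomorphic groups). -/
noncomputable def tateExt (𝒲 : ObjectProperty A) (n : ℤ) (M N : A) [HasTateResolution 𝒲 M] :
    AddCommGrpCat.{v} :=
  (homComplex (tateResolution 𝒲 M).T N).homology n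

end Abstract

section Modules

variable (R : Type u) [CommRing R]

/-- The finitely generated free modules, i.e. the free modules of finite rank. -/
def finiteFree : ObjectProperty (ModuleCat.{u} R) := fun F =>
  Module.Free R F ∧ Module.Finite R F

variable {R}

/-- Semidualizing modules over a commutative ring. -/
structure IsSemidualizing (C : ModuleCat.{u} R) : Prop where
  /-- `C` has a (possibly unbounded) resolution by free modules of finite rank -/
  resolution : Nonempty (Resolution (finiteFree R) C)
  /-- the homothety map `R → Hom_R(C, C)` is an isomorphism -/
  homothety : Function.Bijective (fun r : R => r • (LinearMap.id : C →ₗ[R] C))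
  /-- `Ext^n_R(C, C) = 0` for `n ≥ 1` -/
  ext : ∀ n : ℕ, 1 ≤ n → Subsingleton (Ext.{u} C C n)

/-- The `C`-projective modules `𝒫_C(R)`: those isomorphic to `P ⊗_R C` with `P` projective. -/
def cProjective (C : ModuleCat.{u} R) : ObjectProperty (ModuleCat.{u} R) := fun M =>
  ∃ P : ModuleCat.{u} R, Module.Projective R P ∧ Nonempty (M ≃ₗ[R] P ⊗[R] C)

end Modules

end RelTate

/-! Write `Z_n` for the cokernel of `T_{n+1} ⟶ T_n`. For a totally `𝒲`-acyclic `T`, the group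
`H_{-n}(Hom(T, N))` vanishes exactly when every map `Z_n ⟶ N` factors through an object of `𝒲`
(`isZero_homology_homComplex_iff`), so the theorem is about maps modulo `𝒲`. In a map between two
sequences `0 ⟶ Z_{n+1} ⟶ T_n ⟶ Z_n ⟶ 0`, factoring through `𝒲` passes from the right end to the left
and back (`factorsThrough_τ₁`, `factorsThrough_τ₃`). Hence if one `Z_n` lies in `𝒲`, all do.

If `M` has a finite `𝒲`-resolution, maps to `M` from objects of `𝒢(𝒲)` lift to its first term by
vanishing of `Ext¹`; this gives (ii). Given (ii) for one `n`, apply it to `Z_{-n}`: the `n`-th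
syzygy in a Tate resolution of `Z_{-n}` is `Z_0` modulo `𝒲`, and (iv) follows. Given (iv), the map
`Z_0 ⟶ M` induced by `α` factors through `𝒲`, and so do the maps it induces on higher syzygies.
These are eventually isomorphisms, so all `Z_n` lie in `𝒲`, which gives (iii). Given (iii) for one
`n`, the identity of `Z_n` factors through `𝒲`; then a high syzygy of `W` lies in `𝒲` and `W` can be
cut off there, which gives (i).

For existence, `𝒢(𝒲)` is closed under extensions by a horseshoe argument, so a finite
`𝒢(𝒲)`-resolution can be traded for one whose terms lie in `𝒲`, except for a last syzygy in `𝒢(𝒲)`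
(`syzygyDim_of_syzygyDim_gorenstein`). That syzygy has a Tate resolution, which is spliced back up
to `M`.

For modules it remains to see that `𝒫_C` satisfies the hypotheses: `P ≅ Hom(C, P ⊗ C)` handles
retracts, the resolution of `C` by free modules of finite rank gives orthogonality, and extensions
then split. -/

namespace RelTate

/-! ### Exactness of Hom complexes in terms of liftings and extensions -/

section Criteria

variable {A : Type u} [Category.{v} A] [Abelian A] {ι : Type} {c : ComplexShape ι}

/-- The neighbours of `j` are variables subject to equations, so that degrees can be supplied in any
convenient form. -/
lemma homFromExact_iff (𝒳 : ObjectProperty A) (K : HomologicalComplex A c) :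
    HomFromExact 𝒳 K ↔ ∀ V : A, 𝒳 V → ∀ i j k : ι, c.prev j = i → c.next j = k →
      ∀ f : V ⟶ K.X j, f ≫ K.d j k = 0 → ∃ g : V ⟶ K.X i, g ≫ K.d i j = f := by
  have key : ∀ (V : A) (i j k : ι), c.prev j = i → c.next j = k →
      ((((preadditiveCoyoneda.obj (op V)).mapHomologicalComplex c).obj K).ExactAt j ↔
      ∀ f : V ⟶ K.X j, f ≫ K.d j k = 0 → ∃ g : V ⟶ K.X i, g ≫ K.d i j = f) := by
    intro V i j k hi hk
    rw [HomologicalComplex.exactAt_iff' _ i j k hi hk, ShortComplex.ab_exact_iff]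
    rfl
  constructor
  · intro h V hV i j k hi hk
    exact (key V i j k hi hk).1 (h V hV j)
  · intro h V hV j
    exact (key V _ j _ rfl rfl).2 (h V hV _ j _ rfl rfl)

lemma homComplex_exactAt_iff (K : HomologicalComplex A c) (N : A) {i j k : ι}
    (hi : c.prev j = i) (hk : c.next j = k) :
    (homComplex K N).ExactAt j ↔
      ∀ f : K.X j ⟶ N, K.d i j ≫ f = 0 → ∃ g : K.X k ⟶ N, K.d j k ≫ g = f := by
  rw [HomologicalComplex.exactAt_iff' _ k j i (show c.symm.prev j = k from hk)
    (show c.symm.next j = i from hi), ShortComplex.ab_exact_iff]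
  rfl

lemma homIntoExact_iff (𝒳 : ObjectProperty A) (K : HomologicalComplex A c) :
    HomIntoExact 𝒳 K ↔ ∀ V : A, 𝒳 V → ∀ i j k : ι, c.prev j = i → c.next j = k →
      ∀ f : K.X j ⟶ V, K.d i j ≫ f = 0 → ∃ g : K.X k ⟶ V, K.d j k ≫ g = f := by
  constructor
  · intro h V hV i j k hi hk
    exact (homComplex_exactAt_iff K V hi hk).1 (h V hV j)
  · intro h V hV j
    exact (homComplex_exactAt_iff K V rfl rfl).2 (h V hV _ j _ rfl rfl)

/-- The short complex `Z_i ⟶ K_j ⟶ Z_j` where `Z_n` is the cokernel of the differential arriving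
at `K_n`. -/
noncomputable abbrev syzygySequence (K : HomologicalComplex A c) (i j : ι) : ShortComplex A :=
  ShortComplex.mk (K.fromOpcycles i j) (K.pOpcycles j)
    (by simp [← cancel_epi (K.pOpcycles i)])

/-- The kernel of this map is the homology at `i`. -/
lemma mono_fromOpcycles (K : HomologicalComplex A c) {i j : ι} (hij : c.Rel i j)
    (h : K.ExactAt i) : Mono (K.fromOpcycles i j) := by
  refine Preadditive.mono_of_isZero_kernel' _ (K.homologyIsKernel i j (c.next_eq' hij)) ?_
  exact h.isZero_homology

lemma syzygySequence_shortExact (K : HomologicalComplex A c) {i j : ι} (hij : c.Rel i j)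
    (h : K.ExactAt i) : (syzygySequence K i j).ShortExact := by
  have := mono_fromOpcycles K hij h
  have h' : (ShortComplex.mk (K.d i j) (K.pOpcycles j) (K.d_pOpcycles i j)).Exact :=
    ShortComplex.exact_of_g_is_cokernel _ (K.opcyclesIsCokernel i j (c.prev_eq' hij))
  refine { exact := ?_ }
  -- Replacing `K_i` by its quotient `Z_i` does not change the image in `K_j`.
  let φ : ShortComplex.mk (K.d i j) (K.pOpcycles j) (K.d_pOpcycles i j) ⟶ syzygySequence K i j :=
    { τ₁ := K.pOpcycles i, τ₂ := 𝟙 _, τ₃ := 𝟙 _ }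
  have : Epi φ.τ₁ := inferInstanceAs (Epi (K.pOpcycles i))
  have : IsIso φ.τ₂ := inferInstanceAs (IsIso (𝟙 _))
  have : Mono φ.τ₃ := inferInstanceAs (Mono (𝟙 _))
  exact (ShortComplex.exact_iff_of_epi_of_isIso_of_mono φ).1 h'

end Criteria

/-! ### Morphisms modulo those factoring through `𝒲` -/

section Factoring

set_option linter.unusedSectionVars false

variable {A : Type u} [Category.{v} A] [Abelian A]

/-- The morphism `f` factors through an object of `𝒲`. -/
def FactorsThrough (𝒲 : ObjectProperty A) {X Y : A} (f : X ⟶ Y) : Prop :=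
  ∃ V : A, 𝒲 V ∧ ∃ (a : X ⟶ V) (b : V ⟶ Y), a ≫ b = f

variable {𝒲 : ObjectProperty A}

namespace FactorsThrough

variable {X Y Z : A}

lemma comp_left {f : Y ⟶ Z} (hf : FactorsThrough 𝒲 f) (g : X ⟶ Y) :
    FactorsThrough 𝒲 (g ≫ f) := by
  obtain ⟨V, hV, a, b, rfl⟩ := hf
  exact ⟨V, hV, g ≫ a, b, by simp⟩

lemma comp_right {f : X ⟶ Y} (hf : FactorsThrough 𝒲 f) (g : Y ⟶ Z) :
    FactorsThrough 𝒲 (f ≫ g) := by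
  obtain ⟨V, hV, a, b, rfl⟩ := hf
  exact ⟨V, hV, a, b ≫ g, by simp⟩

lemma add [𝒲.IsClosedUnderExtensions] {f g : X ⟶ Y} (hf : FactorsThrough 𝒲 f)
    (hg : FactorsThrough 𝒲 g) : FactorsThrough 𝒲 (f + g) := by
  obtain ⟨V, hV, a, b, rfl⟩ := hf
  obtain ⟨V', hV', a', b', rfl⟩ := hg
  exact ⟨V ⊞ V', 𝒲.prop_biprod hV hV', biprod.lift a a', biprod.desc b b', by simp⟩

lemma prop_of_id [𝒲.IsStableUnderRetracts] (h : FactorsThrough 𝒲 (𝟙 X)) : 𝒲 X := by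
  obtain ⟨V, hV, a, b, hab⟩ := h
  exact 𝒲.prop_of_retract { i := a, r := b, retract := hab } hV

end FactorsThrough

lemma factorsThrough_id {X : A} (hX : 𝒲 X) : FactorsThrough 𝒲 (𝟙 X) :=
  ⟨X, hX, 𝟙 X, 𝟙 X, by simp⟩

/-- The short complex `S` is `Hom(𝒲, -)`-surjective at its last term. -/
def Lifts (𝒲 : ObjectProperty A) (S : ShortComplex A) : Prop :=
  ∀ V : A, 𝒲 V → ∀ f : V ⟶ S.X₃, ∃ g : V ⟶ S.X₂, g ≫ S.g = f

/-- The short complex `S` is `Hom(-, 𝒲)`-surjective at its first term. -/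
def Extends (𝒲 : ObjectProperty A) (S : ShortComplex A) : Prop :=
  ∀ V : A, 𝒲 V → ∀ f : S.X₁ ⟶ V, ∃ g : S.X₂ ⟶ V, S.f ≫ g = f

/-- Short exact sequences `0 ⟶ X' ⟶ V ⟶ X ⟶ 0` with `V` in `𝒲` which are `Hom(𝒲, -)`-exact. -/
structure IsProperSyzygy (𝒲 : ObjectProperty A) (S : ShortComplex A) : Prop where
  shortExact : S.ShortExact
  mem : 𝒲 S.X₂
  lifts : Lifts 𝒲 S

/-- Short exact sequences `0 ⟶ X' ⟶ V ⟶ X ⟶ 0` with `V` in `𝒲` which are `Hom(𝒲, -)`-exact and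
`Hom(-, 𝒲)`-exact. -/
structure IsTotalSyzygy (𝒲 : ObjectProperty A) (S : ShortComplex A) : Prop
    extends IsProperSyzygy 𝒲 S where
  ext : Extends 𝒲 S

/-- Lift the second factor of `φ.τ₃` along `S'.g` and subtract the resulting map from `φ.τ₂`. The
difference lands in `S'.X₁` and still restricts to `φ.τ₁`, which therefore factors through `S.X₂`.
-/
lemma factorsThrough_τ₁ {S S' : ShortComplex A} (φ : S ⟶ S') (hS : 𝒲 S.X₂)
    (hS' : S'.ShortExact) (hl : Lifts 𝒲 S') (h : FactorsThrough 𝒲 φ.τ₃) :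
    FactorsThrough 𝒲 φ.τ₁ := by
  obtain ⟨V, hV, a, b, hab⟩ := h
  obtain ⟨b', rfl⟩ := hl V hV b
  have := hS'.mono_f
  obtain ⟨s, hs⟩ := hS'.exact.lift' (φ.τ₂ - S.g ≫ a ≫ b') (by simp [← hab, φ.comm₂₃])
  refine ⟨_, hS, S.f, s, ?_⟩
  rw [← cancel_mono S'.f, Category.assoc, hs]
  simp [φ.comm₁₂]

/-- Dual argument: the factorization obtained is through `S'.X₂`. -/
lemma factorsThrough_τ₃ {S S' : ShortComplex A} (φ : S ⟶ S') (hS : S.ShortExact)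
    (he : Extends 𝒲 S) (hS' : 𝒲 S'.X₂) (h : FactorsThrough 𝒲 φ.τ₁) :
    FactorsThrough 𝒲 φ.τ₃ := by
  obtain ⟨V, hV, a, b, hab⟩ := h
  obtain ⟨a', rfl⟩ := he V hV a
  have := hS.epi_g
  obtain ⟨t, ht⟩ := hS.exact.desc' (φ.τ₂ - a' ≫ b ≫ S'.f)
    (by simp [← φ.comm₁₂, ← hab, Category.assoc])
  refine ⟨_, hS', t, S'.g, ?_⟩
  rw [← cancel_epi S.g, reassoc_of% ht]
  simp [φ.comm₂₃]

lemma exists_hom_of_τ₃ {S S' : ShortComplex A} (hS₂ : 𝒲 S.X₂)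
    (hS' : S'.ShortExact) (hl : Lifts 𝒲 S') (f : S.X₃ ⟶ S'.X₃) : ∃ φ : S ⟶ S', φ.τ₃ = f := by
  obtain ⟨g, hg⟩ := hl _ hS₂ (S.g ≫ f)
  have := hS'.mono_f
  obtain ⟨s, hs⟩ := hS'.exact.lift' (S.f ≫ g) (by simp [hg])
  exact ⟨{ τ₁ := s, τ₂ := g, τ₃ := f, comm₁₂ := hs, comm₂₃ := hg }, rfl⟩

lemma exists_hom_of_τ₁ {S S' : ShortComplex A} (hS : S.ShortExact) (he : Extends 𝒲 S)
    (hS' : 𝒲 S'.X₂) (f : S.X₁ ⟶ S'.X₁) : ∃ φ : S ⟶ S', φ.τ₁ = f := by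
  obtain ⟨g, hg⟩ := he _ hS' (f ≫ S'.f)
  have := hS.epi_g
  obtain ⟨s, hs⟩ := hS.exact.desc' (g ≫ S'.g) (by simp [reassoc_of% hg])
  exact ⟨{ τ₁ := f, τ₂ := g, τ₃ := s, comm₁₂ := hg.symm, comm₂₃ := hs.symm }, rfl⟩

/-- `X` is a retract of `Y` in the stable category of `A` modulo the objects of `𝒲`. -/
def StableRetract (𝒲 : ObjectProperty A) (X Y : A) : Prop :=
  ∃ (a : X ⟶ Y) (b : Y ⟶ X), FactorsThrough 𝒲 (𝟙 X - a ≫ b)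

namespace StableRetract

lemma of_iso (h : 𝒲.ContainsZero) {X Y : A} (e : X ≅ Y) : StableRetract 𝒲 X Y := by
  obtain ⟨Z, -, hZ⟩ := h.exists_zero
  exact ⟨e.hom, e.inv, Z, hZ, 0, 0, by simp⟩

lemma congr {X Y X' Y' : A} (h : StableRetract 𝒲 X Y) (e : X ≅ X') (e' : Y ≅ Y') :
    StableRetract 𝒲 X' Y' := by
  obtain ⟨a, b, hab⟩ := h
  refine ⟨e.inv ≫ a ≫ e'.hom, e'.inv ≫ b ≫ e.hom, ?_⟩
  simpa using (hab.comp_left e.inv).comp_right e.hom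

/-- Extend both maps to the sequences; `factorsThrough_τ₁` then applies to the difference of `𝟙 S`
and the composite. -/
lemma τ₁ {S S' : ShortComplex A} (hS : IsProperSyzygy 𝒲 S) (hS' : IsProperSyzygy 𝒲 S')
    (h : StableRetract 𝒲 S.X₃ S'.X₃) : StableRetract 𝒲 S.X₁ S'.X₁ := by
  obtain ⟨a, b, hab⟩ := h
  obtain ⟨φ, rfl⟩ := exists_hom_of_τ₃ hS.mem hS'.shortExact hS'.lifts a
  obtain ⟨ψ, rfl⟩ := exists_hom_of_τ₃ hS'.mem hS.shortExact hS.lifts b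
  exact ⟨φ.τ₁, ψ.τ₁, factorsThrough_τ₁ (𝟙 S - φ ≫ ψ) hS.mem hS.shortExact hS.lifts hab⟩

lemma τ₃ {S S' : ShortComplex A} (hS : IsTotalSyzygy 𝒲 S) (hS' : IsTotalSyzygy 𝒲 S')
    (h : StableRetract 𝒲 S.X₁ S'.X₁) : StableRetract 𝒲 S.X₃ S'.X₃ := by
  obtain ⟨a, b, hab⟩ := h
  obtain ⟨φ, rfl⟩ := exists_hom_of_τ₁ hS.shortExact hS.ext hS'.mem a
  obtain ⟨ψ, rfl⟩ := exists_hom_of_τ₁ hS'.shortExact hS'.ext hS.mem b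
  exact ⟨φ.τ₃, ψ.τ₃, factorsThrough_τ₃ (𝟙 S - φ ≫ ψ) hS.shortExact hS.ext hS.mem hab⟩

lemma factorsThrough [𝒲.IsClosedUnderExtensions] {X Y N : A} (h : StableRetract 𝒲 X Y)
    (hY : ∀ f : Y ⟶ N, FactorsThrough 𝒲 f) (f : X ⟶ N) : FactorsThrough 𝒲 f := by
  obtain ⟨a, b, hab⟩ := h
  -- `f = a ≫ b ≫ f + (𝟙 - a ≫ b) ≫ f`, and both summands factor.
  have := ((hY (b ≫ f)).comp_left a).add (hab.comp_right f)
  simpa using this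

end StableRetract

lemma IsProperSyzygy.prop_τ₁ [𝒲.IsStableUnderRetracts] {S : ShortComplex A}
    (hS : IsProperSyzygy 𝒲 S) (h : 𝒲 S.X₃) : 𝒲 S.X₁ :=
  (factorsThrough_τ₁ (𝟙 S) hS.mem hS.shortExact hS.lifts (factorsThrough_id h)).prop_of_id

lemma IsTotalSyzygy.prop_τ₃ [𝒲.IsStableUnderRetracts] {S : ShortComplex A}
    (hS : IsTotalSyzygy 𝒲 S) (h : 𝒲 S.X₁) : 𝒲 S.X₃ :=
  (factorsThrough_τ₃ (𝟙 S) hS.shortExact hS.ext hS.mem (factorsThrough_id h)).prop_of_id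

end Factoring

/-! ### Totally acyclic complexes as spliced syzygy sequences -/

section Gorenstein

variable {A : Type u} [Category.{v} A] [Abelian A] {𝒲 : ObjectProperty A}

/-- A map `V ⟶ Z_j`, pushed into `T_{j-1}`, is a cycle of `Hom(V, T)`, hence a boundary; this is the
lift. Extensions are found dually from the pullback to `T_i`. -/
lemma isTotalSyzygy_syzygySequence {T : ChainComplex A ℤ} (hT : IsTotallyAcyclic 𝒲 T) {i j : ℤ}
    (hij : j + 1 = i) : IsTotalSyzygy 𝒲 (syzygySequence T i j) where
  shortExact := syzygySequence_shortExact T hij (hT.exact i)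
  mem := hT.mem j
  lifts V hV f := by
    change V ⟶ T.opcycles j at f
    change ∃ g : V ⟶ T.X j, g ≫ T.pOpcycles j = f
    have hjk : (ComplexShape.down ℤ).Rel j (j - 1) := by simp
    have := mono_fromOpcycles T hjk (hT.exact j)
    obtain ⟨g, hg⟩ := (homFromExact_iff 𝒲 T).1 hT.homFrom V hV j (j - 1) (j - 1 - 1)
      (ComplexShape.prev_eq' _ hjk) (ComplexShape.next_eq' _ (by simp))
      (f ≫ T.fromOpcycles j (j - 1)) (by simp)
    refine ⟨g, ?_⟩
    rw [← cancel_mono (T.fromOpcycles j (j - 1)), ← hg]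
    simp
  ext V hV f := by
    change T.opcycles i ⟶ V at f
    change ∃ g : T.X j ⟶ V, T.fromOpcycles i j ≫ g = f
    obtain ⟨g, hg⟩ := (homIntoExact_iff 𝒲 T).1 hT.homInto V hV (i + 1) i j
      (ComplexShape.prev_eq' _ rfl) (ComplexShape.next_eq' _ hij)
      (T.pOpcycles i ≫ f) (by simp)
    refine ⟨g, ?_⟩
    rw [← cancel_epi (T.pOpcycles i), ← hg]
    simp

section Sequence

lemma forall_down_int {P : ℤ → ℤ → ℤ → Prop} (h : ∀ k, P (k + 1 + 1) (k + 1) k) (i j k : ℤ)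
    (hi : (ComplexShape.down ℤ).prev j = i) (hk : (ComplexShape.down ℤ).next j = k) : P i j k := by
  rw [ChainComplex.prev] at hi
  rw [ChainComplex.next] at hk
  obtain rfl : j = k + 1 := by lia
  subst hi
  exact h k

/-- An epimorphism in front changes no image, and a monomorphism behind changes no kernel. -/
lemma exact_of_factors {X₁ X₂ X₃ Y Z : A} {d : X₁ ⟶ X₂} {d' : X₂ ⟶ X₃} (w : d ≫ d' = 0)
    (q : X₁ ⟶ Y) (i : Y ⟶ X₂) (p : X₂ ⟶ Z) (m : Z ⟶ X₃) (hq : q ≫ i = d)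
    (hm : p ≫ m = d') (hip : i ≫ p = 0) (h : (ShortComplex.mk i p hip).Exact) (_ : Epi q) (_ : Mono m) :
    (ShortComplex.mk d d' w).Exact := by
  have w' : i ≫ d' = 0 := by rw [← hm, reassoc_of% hip, zero_comp]
  let φ : ShortComplex.mk i p hip ⟶ ShortComplex.mk i d' w' :=
    { τ₁ := 𝟙 _, τ₂ := 𝟙 _, τ₃ := m }
  have : IsIso φ.τ₂ := inferInstanceAs (IsIso (𝟙 _))
  have : Epi φ.τ₁ := inferInstanceAs (Epi (𝟙 _))
  have : Mono φ.τ₃ := inferInstanceAs (Mono m)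
  let ψ : ShortComplex.mk d d' w ⟶ ShortComplex.mk i d' w' :=
    { τ₁ := q, τ₂ := 𝟙 _, τ₃ := 𝟙 _ }
  have : IsIso ψ.τ₂ := inferInstanceAs (IsIso (𝟙 _))
  have : Epi ψ.τ₁ := inferInstanceAs (Epi q)
  have : Mono ψ.τ₃ := inferInstanceAs (Mono (𝟙 _))
  exact (ShortComplex.exact_iff_of_epi_of_isIso_of_mono ψ).2
    ((ShortComplex.exact_iff_of_epi_of_isIso_of_mono φ).1 h)

variable {T : ChainComplex A ℤ} {K : ℤ → A} {p : ∀ n, T.X n ⟶ K n} {m : ∀ n, K (n + 1) ⟶ T.X n}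
  {w : ∀ n, m n ≫ p n = 0}

/-- Converse of `isTotalSyzygy_syzygySequence`: total syzygies splice to a totally acyclic complex,
since cycles factor through `K` and then lift, and dually. -/
lemma isTotallyAcyclic_of_factors (hd : ∀ n, p (n + 1) ≫ m n = T.d (n + 1) n)
    (h : ∀ n, IsTotalSyzygy 𝒲 (ShortComplex.mk (m n) (p n) (w n))) :
    IsTotallyAcyclic 𝒲 T := by
  have hm : ∀ n, Mono (m n) := fun n => (h n).shortExact.mono_f
  have hp : ∀ n, Epi (p n) := fun n => (h n).shortExact.epi_g
  refine ⟨fun n => (h n).mem, fun j => ?_, ?_, ?_⟩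
  · obtain ⟨k, rfl⟩ : ∃ k, j = k + 1 := ⟨j - 1, by simp⟩
    rw [HomologicalComplex.exactAt_iff' _ (k + 1 + 1) (k + 1) k (by simp) (by simp)]
    exact exact_of_factors _ _ _ _ _ (hd (k + 1)) (hd k) (w (k + 1)) (h (k + 1)).shortExact.exact
      (hp _) (hm _)
  · rw [homFromExact_iff]
    intro V hV
    refine forall_down_int fun k f hf => ?_
    have hf' : f ≫ p (k + 1) = 0 := by
      rw [← cancel_mono (m k), Category.assoc, hd, hf, zero_comp]
    obtain ⟨x, hx⟩ := (h (k + 1)).shortExact.exact.lift' f hf'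
    obtain ⟨y, hy⟩ := (h (k + 1 + 1)).lifts V hV x
    exact ⟨y, by rw [← hd, reassoc_of% hy, hx]⟩
  · rw [homIntoExact_iff]
    intro V hV
    refine forall_down_int fun k f hf => ?_
    have hf' : m (k + 1) ≫ f = 0 := by
      rw [← cancel_epi (p (k + 1 + 1)), reassoc_of% (hd (k + 1)), hf, comp_zero]
    obtain ⟨x, hx⟩ := (h (k + 1)).shortExact.exact.desc' f hf'
    obtain ⟨y, hy⟩ := (h k).ext V hV x
    exact ⟨y, by rw [← hd, Category.assoc, hy, hx]⟩

lemma gorenstein_of_factors (hd : ∀ n, p (n + 1) ≫ m n = T.d (n + 1) n)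
    (h : ∀ n, IsTotalSyzygy 𝒲 (ShortComplex.mk (m n) (p n) (w n))) :
    gorenstein 𝒲 (K 0) := by
  refine ⟨T, isTotallyAcyclic_of_factors hd h, ?_⟩
  have := (h 0).shortExact.epi_g
  have := (h 1).shortExact.epi_g
  have hd0 : p 1 ≫ m 0 = T.d 1 0 := hd 0
  have hcok : IsColimit (CokernelCofork.ofπ (f := T.d 1 0) (p 0) (by simp [← hd0, w])) := by
    refine CokernelCofork.IsColimit.ofπ' _ _ fun {Z} g hg => ?_
    have hg' : m 0 ≫ g = 0 := by
      rw [← cancel_epi (p 1), reassoc_of% hd0, hg, comp_zero]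
    exact ⟨(h 0).shortExact.exact.desc g hg', (h 0).shortExact.exact.g_desc g hg'⟩
  exact ⟨hcok.coconePointUniqueUpToIso (colimit.isColimit _)⟩

lemma IsTotalSyzygy.of_iso_left {S : ShortComplex A} (hS : IsTotalSyzygy 𝒲 S) {X : A}
    (e : X ≅ S.X₁) : IsTotalSyzygy 𝒲 (ShortComplex.mk (e.hom ≫ S.f) S.g (by simp)) where
  shortExact := ShortComplex.shortExact_of_iso
    (ShortComplex.isoMk e.symm (Iso.refl _) (Iso.refl _)) hS.shortExact
  mem := hS.mem
  lifts := hS.lifts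
  ext V hV f := by
    obtain ⟨g, hg⟩ := hS.ext V hV (e.inv ≫ f)
    exact ⟨g, by simp [hg]⟩

lemma gorenstein_of_sequence (S : ℤ → ShortComplex A) (e : ∀ n, (S (n + 1)).X₃ ≅ (S n).X₁)
    (hS : ∀ n, IsTotalSyzygy 𝒲 (S n)) : gorenstein 𝒲 (S 0).X₃ :=
  gorenstein_of_factors (K := fun n => (S n).X₃)
    (T := ChainComplex.of (fun n => (S n).X₂) (fun n => (S (n + 1)).g ≫ (e n).hom ≫ (S n).f)
      (fun n => by simp [(S (n + 1)).zero_assoc]))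
    (fun n => (ChainComplex.of_d (fun n => (S n).X₂)
      (fun n => (S (n + 1)).g ≫ (e n).hom ≫ (S n).f) n).symm)
    (fun n => (hS n).of_iso_left (e n))

end Sequence

lemma gorenstein_of_iso {X Y : A} (e : X ≅ Y) (hX : gorenstein 𝒲 X) : gorenstein 𝒲 Y := by
  obtain ⟨T, hT, ⟨e'⟩⟩ := hX
  exact ⟨T, hT, ⟨e.symm ≪≫ e'⟩⟩

instance : (gorenstein 𝒲).IsClosedUnderIsomorphisms where
  of_iso := gorenstein_of_iso

/-- Every object of `𝒳` is the last term, and the first term, of a totally `𝒲`-exact sequence with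
middle term in `𝒲` and with the other end again in `𝒳`. -/
structure IsSyzygyClosed (𝒲 𝒳 : ObjectProperty A) : Prop where
  left : ∀ X : A, 𝒳 X → ∃ S : ShortComplex A, IsTotalSyzygy 𝒲 S ∧ Nonempty (S.X₃ ≅ X) ∧ 𝒳 S.X₁
  right : ∀ X : A, 𝒳 X → ∃ S : ShortComplex A, IsTotalSyzygy 𝒲 S ∧ Nonempty (S.X₁ ≅ X) ∧ 𝒳 S.X₃

theorem IsSyzygyClosed.le_gorenstein {𝒳 : ObjectProperty A} (h : IsSyzygyClosed 𝒲 𝒳) :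
    𝒳 ≤ gorenstein 𝒲 := by
  intro X hX
  choose L hL eL hL' using h.left
  choose Q hQ eQ hQ' using h.right
  let l : ℕ → Subtype 𝒳 := fun n => Nat.rec ⟨X, hX⟩ (fun _ Y => ⟨(L Y.1 Y.2).X₁, hL' Y.1 Y.2⟩) n
  let q : ℕ → Subtype 𝒳 := fun n => Nat.rec ⟨X, hX⟩ (fun _ Y => ⟨(Q Y.1 Y.2).X₃, hQ' Y.1 Y.2⟩) n
  -- Nonnegative degrees continue to the left of `X`, negative ones to its right; the halves meet at
  -- `X`, between degrees `0` and `-1`.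
  let S : ℤ → ShortComplex A := fun n => match n with
    | Int.ofNat n => L (l n).1 (l n).2
    | Int.negSucc n => Q (q n).1 (q n).2
  have hS : ∀ n, IsTotalSyzygy 𝒲 (S n) := by
    rintro (n | n)
    · exact hL _ _
    · exact hQ _ _
  have e : ∀ n, Nonempty ((S (n + 1)).X₃ ≅ (S n).X₁) := by
    rintro (n | n | n)
    · exact eL (l (n + 1)).1 (l (n + 1)).2
    · obtain ⟨i⟩ := eL X hX
      obtain ⟨j⟩ := eQ X hX
      exact ⟨i ≪≫ j.symm⟩
    · obtain ⟨j⟩ := eQ (q (n + 1)).1 (q (n + 1)).2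
      exact ⟨j.symm⟩
  exact gorenstein_of_iso (eL X hX).some (gorenstein_of_sequence S (fun n => (e n).some) hS)

/-- The objects isomorphic to a syzygy of a totally acyclic complex. -/
lemma isSyzygyClosed_opcycles :
    IsSyzygyClosed 𝒲 (fun X => ∃ T : ChainComplex A ℤ, IsTotallyAcyclic 𝒲 T ∧
      ∃ j, Nonempty (X ≅ T.opcycles j)) where
  left := by
    rintro X ⟨T, hT, j, ⟨e⟩⟩
    exact ⟨syzygySequence T (j + 1) j, isTotalSyzygy_syzygySequence hT rfl, ⟨e.symm⟩,
      T, hT, j + 1, ⟨Iso.refl _⟩⟩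
  right := by
    rintro X ⟨T, hT, j, ⟨e⟩⟩
    exact ⟨syzygySequence T j (j - 1), isTotalSyzygy_syzygySequence hT (by simp), ⟨e.symm⟩,
      T, hT, j - 1, ⟨Iso.refl _⟩⟩

/-- No shift of `T` is needed: the class of syzygies in all degrees is closed on both sides. -/
lemma gorenstein_opcycles {T : ChainComplex A ℤ} (hT : IsTotallyAcyclic 𝒲 T) (j : ℤ) :
    gorenstein 𝒲 (T.opcycles j) :=
  isSyzygyClosed_opcycles.le_gorenstein _ ⟨T, hT, j, ⟨Iso.refl _⟩⟩

lemma gorenstein_eq : gorenstein 𝒲 = fun X => ∃ T : ChainComplex A ℤ, IsTotallyAcyclic 𝒲 T ∧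
      ∃ j, Nonempty (X ≅ T.opcycles j) := by
  ext X
  constructor
  · rintro ⟨T, hT, ⟨e⟩⟩
    exact ⟨T, hT, 0, ⟨e ≪≫ (cokernelIsCokernel _).coconePointUniqueUpToIso
      (T.opcyclesIsCokernel 1 0 (by simp))⟩⟩
  · exact isSyzygyClosed_opcycles.le_gorenstein X

lemma isSyzygyClosed_gorenstein : IsSyzygyClosed 𝒲 (gorenstein 𝒲) := by
  rw [gorenstein_eq]
  exact isSyzygyClosed_opcycles

end Gorenstein

/-! ### Vanishing of Ext along short exact sequences -/

section ExtVanishing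

variable {A : Type u} [Category.{v} A] [Abelian A] [HasExt.{w} A]

/-- `Ext^n(X, Y) = 0` for all `n ≥ 1`. -/
def ExtVanishes (X Y : A) : Prop := ∀ n : ℕ, 1 ≤ n → Subsingleton (Ext.{w} X Y n)

namespace ExtVanishes

lemma of_forall_succ {X Y : A} (h : ∀ n : ℕ, ∀ x : Ext.{w} X Y (n + 1), x = 0) :
    ExtVanishes.{w} X Y := by
  rintro (_ | n) hn
  · lia
  · exact ⟨fun a b => by rw [h n a, h n b]⟩

lemma eq_zero {X Y : A} (h : ExtVanishes.{w} X Y) {n : ℕ} (hn : 1 ≤ n) (x : Ext.{w} X Y n) :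
    x = 0 :=
  (h n hn).elim _ _

lemma of_retract_left {X X' Y : A} (h : ExtVanishes.{w} X Y) (r : Retract X' X) :
    ExtVanishes.{w} X' Y := by
  refine of_forall_succ fun n x => ?_
  have h1 : (Ext.mk₀ r.r).comp x (zero_add _) = 0 := h.eq_zero (by lia) _
  have h2 : (Ext.mk₀ r.i).comp ((Ext.mk₀ r.r).comp x (zero_add _)) (zero_add _) = x := by
    rw [Ext.mk₀_comp_mk₀_assoc, r.retract, Ext.mk₀_id_comp]
  rw [← h2, h1, Ext.comp_zero]

lemma of_retract_right {X Y Y' : A} (h : ExtVanishes.{w} X Y) (r : Retract Y' Y) :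
    ExtVanishes.{w} X Y' := by
  refine of_forall_succ fun n x => ?_
  have h1 : x.comp (Ext.mk₀ r.i) (add_zero _) = 0 := h.eq_zero (by lia) _
  have h2 : (x.comp (Ext.mk₀ r.i) (add_zero _)).comp (Ext.mk₀ r.r) (add_zero _) = x := by
    rw [Ext.comp_assoc_of_third_deg_zero, Ext.mk₀_comp_mk₀, r.retract, Ext.comp_mk₀_id]
  rw [← h2, h1, Ext.zero_comp]

variable {S : ShortComplex A} (hS : S.ShortExact)

include hS

lemma covariant_X₂ {X : A} (h₁ : ExtVanishes.{w} X S.X₁) (h₃ : ExtVanishes.{w} X S.X₃) :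
    ExtVanishes.{w} X S.X₂ := by
  refine of_forall_succ fun n x => ?_
  obtain ⟨y, rfl⟩ := Ext.covariant_sequence_exact₂ X hS x (h₃.eq_zero (by lia) _)
  rw [h₁.eq_zero (by lia) y, Ext.zero_comp]

lemma covariant_X₃ {X : A} (h₁ : ExtVanishes.{w} X S.X₁) (h₂ : ExtVanishes.{w} X S.X₂) :
    ExtVanishes.{w} X S.X₃ := by
  refine of_forall_succ fun n x => ?_
  obtain ⟨y, rfl⟩ := Ext.covariant_sequence_exact₃ X hS x rfl (h₁.eq_zero (by lia) _)
  rw [h₂.eq_zero (by lia) y, Ext.zero_comp]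

lemma contravariant_X₂ {Y : A} (h₁ : ExtVanishes.{w} S.X₁ Y) (h₃ : ExtVanishes.{w} S.X₃ Y) :
    ExtVanishes.{w} S.X₂ Y := by
  refine of_forall_succ fun n x => ?_
  obtain ⟨y, rfl⟩ := Ext.contravariant_sequence_exact₂ hS Y x (h₁.eq_zero (by lia) _)
  rw [h₃.eq_zero (by lia) y, Ext.comp_zero]

lemma exists_lift {X : A} (h₁ : Subsingleton (Ext.{w} X S.X₁ 1)) (f : X ⟶ S.X₃) :
    ∃ g : X ⟶ S.X₂, g ≫ S.g = f := by
  obtain ⟨y, hy⟩ := Ext.covariant_sequence_exact₃ X hS (Ext.mk₀ f) (zero_add 1) (h₁.elim _ _)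
  obtain ⟨g, rfl⟩ := (Ext.mk₀_bijective _ _).2 y
  exact ⟨g, (Ext.mk₀_bijective _ _).1 (by rw [← hy, Ext.mk₀_comp_mk₀])⟩

lemma exists_extension {Y : A} (h₃ : Subsingleton (Ext.{w} S.X₃ Y 1)) (f : S.X₁ ⟶ Y) :
    ∃ g : S.X₂ ⟶ Y, S.f ≫ g = f := by
  obtain ⟨y, hy⟩ := Ext.contravariant_sequence_exact₁ hS Y (Ext.mk₀ f) (add_zero 1) (h₃.elim _ _)
  obtain ⟨g, rfl⟩ := (Ext.mk₀_bijective _ _).2 y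
  exact ⟨g, (Ext.mk₀_bijective _ _).1 (by rw [← hy, Ext.mk₀_comp_mk₀])⟩

/-- Each class is the image of a map `X ⟶ S.X₃` under the connecting homomorphism, which kills maps
that lift. -/
lemma subsingleton_ext_one_X₁ {X : A} (h : ∀ f : X ⟶ S.X₃, ∃ g : X ⟶ S.X₂, g ≫ S.g = f)
    (h₂ : Subsingleton (Ext.{w} X S.X₂ 1)) : Subsingleton (Ext.{w} X S.X₁ 1) := by
  refine subsingleton_of_forall_eq 0 fun x => ?_
  obtain ⟨y, rfl⟩ := Ext.covariant_sequence_exact₁ X hS x (h₂.elim _ _) (zero_add 1)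
  obtain ⟨f, rfl⟩ := (Ext.mk₀_bijective _ _).2 y
  obtain ⟨g, rfl⟩ := h f
  rw [← Ext.mk₀_comp_mk₀, Ext.comp_assoc_of_second_deg_zero, hS.comp_extClass, Ext.comp_zero]

lemma subsingleton_ext_one_X₃ {Y : A} (h : ∀ f : S.X₁ ⟶ Y, ∃ g : S.X₂ ⟶ Y, S.f ≫ g = f)
    (h₂ : Subsingleton (Ext.{w} S.X₂ Y 1)) : Subsingleton (Ext.{w} S.X₃ Y 1) := by
  refine subsingleton_of_forall_eq 0 fun x => ?_
  obtain ⟨y, rfl⟩ := Ext.contravariant_sequence_exact₃ hS Y x (h₂.elim _ _) (add_zero 1)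
  obtain ⟨f, rfl⟩ := (Ext.mk₀_bijective _ _).2 y
  obtain ⟨g, rfl⟩ := h f
  rw [← Ext.mk₀_comp_mk₀, ← Ext.comp_assoc_of_second_deg_zero, hS.extClass_comp, Ext.zero_comp]

lemma subsingleton_ext_X₁ {X : A} {n : ℕ} (h₃ : Subsingleton (Ext.{w} X S.X₃ n))
    (h₂ : Subsingleton (Ext.{w} X S.X₂ (n + 1))) : Subsingleton (Ext.{w} X S.X₁ (n + 1)) := by
  refine subsingleton_of_forall_eq 0 fun x => ?_
  obtain ⟨y, rfl⟩ := Ext.covariant_sequence_exact₁ X hS x (h₂.elim _ _) rfl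
  rw [h₃.elim y 0, Ext.zero_comp]

lemma subsingleton_ext_X₃ {Y : A} {n : ℕ} (h₁ : Subsingleton (Ext.{w} S.X₁ Y n))
    (h₂ : Subsingleton (Ext.{w} S.X₂ Y (n + 1))) : Subsingleton (Ext.{w} S.X₃ Y (n + 1)) := by
  refine subsingleton_of_forall_eq 0 fun x => ?_
  obtain ⟨y, rfl⟩ := Ext.contravariant_sequence_exact₃ hS Y x (h₂.elim _ _) (add_comm _ _)
  rw [h₁.elim y 0, Ext.comp_zero]

end ExtVanishes

end ExtVanishing

/-! ### Kernels and cokernels of morphisms of short exact sequences -/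

section NineLemma

variable {A : Type u} [Category.{v} A] [Abelian A]

/-- The snake input attached to a morphism of short exact sequences. -/
noncomputable def snakeInput {R S : ShortComplex A} (φ : R ⟶ S) (hR : R.ShortExact)
    (hS : S.ShortExact) : ShortComplex.SnakeInput A where
  L₀ := kernel φ
  L₁ := R
  L₂ := S
  L₃ := cokernel φ
  v₀₁ := kernel.ι φ
  v₁₂ := φ
  v₂₃ := cokernel.π φ
  h₀ := kernelIsKernel φ
  h₃ := cokernelIsCokernel φ
  L₁_exact := hR.exact
  epi_L₁_g := hR.epi_g
  L₂_exact := hS.exact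
  mono_L₂_f := hS.mono_f

/-- By the snake lemma: the connecting morphism has target the cokernel of `φ.τ₁`, which is zero. -/
lemma kernel_shortExact {R S : ShortComplex A} (φ : R ⟶ S) (hR : R.ShortExact)
    (hS : S.ShortExact) (h₁ : Epi φ.τ₁) : (kernel φ).ShortExact := by
  let D := snakeInput φ hR hS
  have h0 : IsZero D.L₃.X₁ := by
    have h : Epi D.v₂₃.τ₁ := inferInstance
    refine IsZero.of_epi_eq_zero D.v₂₃.τ₁ ?_
    have : Epi D.v₁₂.τ₁ := h₁
    rw [← cancel_epi D.v₁₂.τ₁, D.w₁₃_τ₁, comp_zero]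
  have : Mono D.L₁.f := hR.mono_f
  have hm : Mono D.L₀.f := inferInstance
  have he : Epi D.L₀.g := D.L₁'_exact.epi_f (h0.eq_of_tgt _ _)
  exact { exact := D.L₀_exact, mono_f := hm, epi_g := he }

lemma cokernel_shortExact {R S : ShortComplex A} (φ : R ⟶ S) (hR : R.ShortExact)
    (hS : S.ShortExact) (h₃ : Mono φ.τ₃) : (cokernel φ).ShortExact := by
  let D := snakeInput φ hR hS
  have h0 : IsZero D.L₀.X₃ := by
    have h : Mono D.v₀₁.τ₃ := inferInstance
    refine IsZero.of_mono_eq_zero D.v₀₁.τ₃ ?_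
    have : Mono D.v₁₂.τ₃ := h₃
    rw [← cancel_mono D.v₁₂.τ₃, D.w₀₂_τ₃, zero_comp]
  have : Epi D.L₂.g := hS.epi_g
  have hm : Epi D.L₃.g := inferInstance
  have he : Mono D.L₃.f := D.L₂'_exact.mono_g (h0.eq_of_src _ _)
  exact { exact := D.L₃_exact, mono_f := he, epi_g := hm }

lemma exists_kernel_shortExact {R S : ShortComplex A} (φ : R ⟶ S) (hR : R.ShortExact)
    (hS : S.ShortExact) (h₁ : Epi φ.τ₁) (h₃ : Epi φ.τ₃) :
    ∃ (K : ShortComplex A) (κ : K ⟶ R) (w₁ : κ.τ₁ ≫ φ.τ₁ = 0) (w₂ : κ.τ₂ ≫ φ.τ₂ = 0)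
      (w₃ : κ.τ₃ ≫ φ.τ₃ = 0), K.ShortExact ∧ (ShortComplex.mk _ _ w₁).ShortExact ∧
        (ShortComplex.mk _ _ w₂).ShortExact ∧ (ShortComplex.mk _ _ w₃).ShortExact := by
  let D := snakeInput φ hR hS
  have h₂ : Epi φ.τ₂ := ShortComplex.epi_of_epi_of_epi_of_epi φ hS.exact hR.epi_g h₁ h₃
  refine ⟨kernel φ, kernel.ι φ, D.w₀₂_τ₁, D.w₀₂_τ₂, D.w₀₂_τ₃, kernel_shortExact φ hR hS h₁,
    .mk' D.exact_C₁_up D.mono_v₀₁_τ₁ h₁, .mk' D.exact_C₂_up D.mono_v₀₁_τ₂ h₂,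
    .mk' D.exact_C₃_up D.mono_v₀₁_τ₃ h₃⟩

lemma exists_cokernel_shortExact {R S : ShortComplex A} (φ : R ⟶ S) (hR : R.ShortExact)
    (hS : S.ShortExact) (h₁ : Mono φ.τ₁) (h₃ : Mono φ.τ₃) :
    ∃ (K : ShortComplex A) (κ : S ⟶ K) (w₁ : φ.τ₁ ≫ κ.τ₁ = 0) (w₂ : φ.τ₂ ≫ κ.τ₂ = 0)
      (w₃ : φ.τ₃ ≫ κ.τ₃ = 0), K.ShortExact ∧ (ShortComplex.mk _ _ w₁).ShortExact ∧
        (ShortComplex.mk _ _ w₂).ShortExact ∧ (ShortComplex.mk _ _ w₃).ShortExact := by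
  let D := snakeInput φ hR hS
  have h₂ : Mono φ.τ₂ := ShortComplex.mono_of_mono_of_mono_of_mono φ hR.exact hS.mono_f h₁ h₃
  refine ⟨cokernel φ, cokernel.π φ, D.w₁₃_τ₁, D.w₁₃_τ₂, D.w₁₃_τ₃, cokernel_shortExact φ hR hS h₃,
    .mk' D.exact_C₁_down h₁ D.epi_v₂₃_τ₁, .mk' D.exact_C₂_down h₂ D.epi_v₂₃_τ₂,
    .mk' D.exact_C₃_down h₃ D.epi_v₂₃_τ₃⟩

lemma nonempty_iso_X₁ {X₁ X₁' X₂ X₃ : A} {f : X₁ ⟶ X₂} {f' : X₁' ⟶ X₂} {g : X₂ ⟶ X₃}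
    {w : f ≫ g = 0} {w' : f' ≫ g = 0} (h : (ShortComplex.mk f g w).ShortExact)
    (h' : (ShortComplex.mk f' g w').ShortExact) : Nonempty (X₁ ≅ X₁') :=
  ⟨h.fIsKernel.conePointUniqueUpToIso h'.fIsKernel⟩

lemma nonempty_iso_X₃ {X₁ X₂ X₃ X₃' : A} {f : X₁ ⟶ X₂} {g : X₂ ⟶ X₃} {g' : X₂ ⟶ X₃'}
    {w : f ≫ g = 0} {w' : f ≫ g' = 0} (h : (ShortComplex.mk f g w).ShortExact)
    (h' : (ShortComplex.mk f g' w').ShortExact) : Nonempty (X₃ ≅ X₃') :=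
  ⟨h.gIsCokernel.coconePointUniqueUpToIso h'.gIsCokernel⟩

end NineLemma

/-! ### Horseshoe lemmas, and `𝒲`-resolutions ending in `𝒢(𝒲)` -/

section Closure

variable {A : Type u} [Category.{v} A] [Abelian A] {𝒲 : ObjectProperty A}

lemma IsTotalSyzygy.of_iso_right {S : ShortComplex A} (hS : IsTotalSyzygy 𝒲 S) {X : A}
    (e : S.X₃ ≅ X) : IsTotalSyzygy 𝒲 (ShortComplex.mk S.f (S.g ≫ e.hom) (by simp)) where
  shortExact := ShortComplex.shortExact_of_iso
    (ShortComplex.isoMk (S₁ := S) (Iso.refl _) (Iso.refl _) e) hS.shortExact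
  mem := hS.mem
  ext := hS.ext
  lifts V hV f := by
    obtain ⟨g, hg⟩ := hS.lifts V hV (f ≫ e.inv)
    exact ⟨g, by simp [reassoc_of% hg]⟩

lemma IsSyzygyClosed.exists_left {𝒳 : ObjectProperty A} (h : IsSyzygyClosed 𝒲 𝒳) {X : A}
    (hX : 𝒳 X) : ∃ (K P : A) (i : K ⟶ P) (p : P ⟶ X) (w : i ≫ p = 0),
      IsTotalSyzygy 𝒲 (ShortComplex.mk i p w) ∧ 𝒳 K := by
  obtain ⟨S, hS, ⟨e⟩, hK⟩ := h.left X hX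
  exact ⟨_, _, _, _, _, hS.of_iso_right e, hK⟩

lemma IsSyzygyClosed.exists_right {𝒳 : ObjectProperty A} (h : IsSyzygyClosed 𝒲 𝒳) {X : A}
    (hX : 𝒳 X) : ∃ (K P : A) (i : X ⟶ P) (p : P ⟶ K) (w : i ≫ p = 0),
      IsTotalSyzygy 𝒲 (ShortComplex.mk i p w) ∧ 𝒳 K := by
  obtain ⟨S, hS, ⟨e⟩, hK⟩ := h.right X hX
  exact ⟨_, _, _, _, _, hS.of_iso_left e.symm, hK⟩

/-- The given lift of `p₃` takes the place of projectivity of `P₃`. -/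
lemma exists_horseshoe {S : ShortComplex A} (hS : S.ShortExact) {K₁ P₁ K₃ P₃ : A}
    {i₁ : K₁ ⟶ P₁} {p₁ : P₁ ⟶ S.X₁} {w₁ : i₁ ≫ p₁ = 0} (h₁ : (ShortComplex.mk i₁ p₁ w₁).ShortExact)
    {i₃ : K₃ ⟶ P₃} {p₃ : P₃ ⟶ S.X₃} {w₃ : i₃ ≫ p₃ = 0} (h₃ : (ShortComplex.mk i₃ p₃ w₃).ShortExact)
    (hl : ∃ l : P₃ ⟶ S.X₂, l ≫ S.g = p₃) :
    ∃ (K : ShortComplex A), K.ShortExact ∧ Nonempty (K.X₁ ≅ K₁) ∧ Nonempty (K.X₃ ≅ K₃) ∧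
      ∃ (i : K.X₂ ⟶ P₁ ⊞ P₃) (p : P₁ ⊞ P₃ ⟶ S.X₂) (w : i ≫ p = 0),
        (ShortComplex.mk i p w).ShortExact := by
  obtain ⟨l, hl⟩ := hl
  let φ : ShortComplex.mk (biprod.inl : P₁ ⟶ P₁ ⊞ P₃) biprod.snd biprod.inl_snd ⟶ S :=
    { τ₁ := p₁, τ₂ := biprod.desc (p₁ ≫ S.f) l, τ₃ := p₃
      comm₁₂ := by simp
      comm₂₃ := by ext <;> simp [hl] }
  obtain ⟨K, κ, w₁', w₂', w₃', hK, hK₁, hK₂, hK₃⟩ := exists_kernel_shortExact φ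
    (ShortComplex.Splitting.ofHasBinaryBiproduct P₁ P₃).shortExact hS h₁.epi_g h₃.epi_g
  exact ⟨K, hK, nonempty_iso_X₁ hK₁ h₁, nonempty_iso_X₁ hK₃ h₃, _, _, w₂', hK₂⟩

lemma exists_cohorseshoe {S : ShortComplex A} (hS : S.ShortExact) {K₁ P₁ K₃ P₃ : A}
    {i₁ : S.X₁ ⟶ P₁} {p₁ : P₁ ⟶ K₁} {w₁ : i₁ ≫ p₁ = 0} (h₁ : (ShortComplex.mk i₁ p₁ w₁).ShortExact)
    {i₃ : S.X₃ ⟶ P₃} {p₃ : P₃ ⟶ K₃} {w₃ : i₃ ≫ p₃ = 0} (h₃ : (ShortComplex.mk i₃ p₃ w₃).ShortExact)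
    (hl : ∃ l : S.X₂ ⟶ P₁, S.f ≫ l = i₁) :
    ∃ (K : ShortComplex A), K.ShortExact ∧ Nonempty (K.X₁ ≅ K₁) ∧ Nonempty (K.X₃ ≅ K₃) ∧
      ∃ (i : S.X₂ ⟶ P₁ ⊞ P₃) (p : P₁ ⊞ P₃ ⟶ K.X₂) (w : i ≫ p = 0),
        (ShortComplex.mk i p w).ShortExact := by
  obtain ⟨l, hl⟩ := hl
  let φ : S ⟶ ShortComplex.mk (biprod.inl : P₁ ⟶ P₁ ⊞ P₃) biprod.snd biprod.inl_snd :=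
    { τ₁ := i₁, τ₂ := biprod.lift l (S.g ≫ i₃), τ₃ := i₃
      comm₁₂ := by ext <;> simp [hl]
      comm₂₃ := by simp }
  obtain ⟨K, κ, w₁', w₂', w₃', hK, hK₁, hK₂, hK₃⟩ := exists_cokernel_shortExact φ hS
    (ShortComplex.Splitting.ofHasBinaryBiproduct P₁ P₃).shortExact h₁.mono_f h₃.mono_f
  exact ⟨K, hK, nonempty_iso_X₃ hK₁ h₁, nonempty_iso_X₃ hK₃ h₃, _, _, w₂', hK₂⟩

open scoped ZeroObject in
lemma exists_kernel_comp {K P X L E : A} {i : K ⟶ P} {p : P ⟶ X} {w₁ : i ≫ p = 0}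
    (h₁ : (ShortComplex.mk i p w₁).ShortExact) {j : L ⟶ X} {q : X ⟶ E} {w₂ : j ≫ q = 0}
    (h₂ : (ShortComplex.mk j q w₂).ShortExact) :
    ∃ N : ShortComplex A, N.ShortExact ∧ Nonempty (N.X₁ ≅ K) ∧ Nonempty (N.X₃ ≅ L) ∧
      ∃ (k : N.X₂ ⟶ P) (w : k ≫ p ≫ q = 0), (ShortComplex.mk k (p ≫ q) w).ShortExact := by
  -- The kernel of this map onto `0 ⟶ E ⟶ E` exhibits `ker (p ≫ q)` as an extension of `ker q` by
  -- `ker p`.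
  let φ : ShortComplex.mk i p w₁ ⟶ ShortComplex.mk (0 : (0 : A) ⟶ E) (𝟙 E) (by simp) :=
    { τ₁ := 0, τ₂ := p ≫ q, τ₃ := q
      comm₁₂ := by simp [reassoc_of% w₁]
      comm₂₃ := by simp }
  have hE : (ShortComplex.mk (0 : (0 : A) ⟶ E) (𝟙 E) (by simp)).ShortExact :=
    .mk' ((ShortComplex.exact_iff_mono _ rfl).2 inferInstance) inferInstance inferInstance
  obtain ⟨N, κ, w₁', w₂', w₃', hN, hN₁, hN₂, hN₃⟩ := exists_kernel_shortExact φ h₁ hE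
    (inferInstanceAs (Epi (0 : K ⟶ (0 : A)))) h₂.epi_g
  have : Mono κ.τ₁ := hN₁.mono_f
  have : IsIso κ.τ₁ := (hN₁.isIso_f_iff).2 (isZero_zero A)
  exact ⟨N, hN, ⟨asIso κ.τ₁⟩, nonempty_iso_X₁ hN₃ h₂, κ.τ₂, w₂', hN₂⟩

/-- The objects that have a resolution of length `n` with terms in `ℳ` and last syzygy in `𝒳`. -/
def syzygyDim (ℳ 𝒳 : ObjectProperty A) : ℕ → ObjectProperty A
  | 0 => 𝒳
  | n + 1 => fun X => ∃ (K P : A) (i : K ⟶ P) (p : P ⟶ X) (w : i ≫ p = 0),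
      (ShortComplex.mk i p w).ShortExact ∧ ℳ P ∧ syzygyDim ℳ 𝒳 n K

lemma syzygyDim_of_iso {ℳ 𝒳 : ObjectProperty A} [𝒳.IsClosedUnderIsomorphisms] :
    ∀ {n : ℕ} {X Y : A} (_ : X ≅ Y), syzygyDim ℳ 𝒳 n X → syzygyDim ℳ 𝒳 n Y
  | 0, _, _, e, h => 𝒳.prop_of_iso e h
  | _ + 1, _, _, e, ⟨K, P, i, p, w, h, hP, hK⟩ =>
    ⟨K, P, i, p ≫ e.hom, by rw [reassoc_of% w, zero_comp], ShortComplex.shortExact_of_iso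
      (ShortComplex.isoMk (S₁ := ShortComplex.mk i p w) (Iso.refl _) (Iso.refl _) e) h, hP, hK⟩

variable [HasExt.{w} A]

lemma syzygyDim_extVanishes {ℳ 𝒳 : ObjectProperty A} {V : A}
    (hℳ : ∀ X, ℳ X → ExtVanishes.{w} V X) (h𝒳 : ∀ X, 𝒳 X → ExtVanishes.{w} V X) :
    ∀ {n : ℕ} {X : A}, syzygyDim ℳ 𝒳 n X → ExtVanishes.{w} V X
  | 0, _, h => h𝒳 _ h
  | _ + 1, _, ⟨_, _, _, _, _, h, hP, hK⟩ =>
    ExtVanishes.covariant_X₃ h (syzygyDim_extVanishes hℳ h𝒳 hK) (hℳ _ hP)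

variable (hO : Orthogonal.{w} 𝒲 𝒲)

include hO

/-- Degree one is `Hom(-, 𝒲)`-exactness of a total syzygy sequence; higher degrees shift to the next
syzygy, again in `𝒢(𝒲)`. -/
lemma gorenstein_extVanishes_left {X V : A} (hX : gorenstein 𝒲 X) (hV : 𝒲 V) :
    ExtVanishes.{w} X V := by
  suffices h : ∀ (n : ℕ) (X : A), gorenstein 𝒲 X → Subsingleton (Ext.{w} X V (n + 1)) from
    ExtVanishes.of_forall_succ fun n x => (h n X hX).elim _ _
  intro n
  induction n with
  | zero =>
    intro X hX
    obtain ⟨K, P, i, p, w, hS, hK⟩ := isSyzygyClosed_gorenstein.exists_left hX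
    exact ExtVanishes.subsingleton_ext_one_X₃ hS.shortExact (hS.ext V hV) (hO _ _ hS.mem hV 1 le_rfl)
  | succ n ih =>
    intro X hX
    obtain ⟨K, P, i, p, w, hS, hK⟩ := isSyzygyClosed_gorenstein.exists_left hX
    exact ExtVanishes.subsingleton_ext_X₃ hS.shortExact (ih _ hK) (hO _ _ hS.mem hV _ (by lia))

lemma gorenstein_extVanishes_right {X V : A} (hX : gorenstein 𝒲 X) (hV : 𝒲 V) :
    ExtVanishes.{w} V X := by
  suffices h : ∀ (n : ℕ) (X : A), gorenstein 𝒲 X → Subsingleton (Ext.{w} V X (n + 1)) from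
    ExtVanishes.of_forall_succ fun n x => (h n X hX).elim _ _
  intro n
  induction n with
  | zero =>
    intro X hX
    obtain ⟨K, P, i, p, w, hS, hK⟩ := isSyzygyClosed_gorenstein.exists_right hX
    exact ExtVanishes.subsingleton_ext_one_X₁ hS.shortExact (hS.lifts V hV)
      (hO _ _ hV hS.mem 1 le_rfl)
  | succ n ih =>
    intro X hX
    obtain ⟨K, P, i, p, w, hS, hK⟩ := isSyzygyClosed_gorenstein.exists_right hX
    exact ExtVanishes.subsingleton_ext_X₁ hS.shortExact (ih _ hK) (hO _ _ hV hS.mem _ (by lia))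

variable [𝒲.IsClosedUnderExtensions]

/-- It suffices that the class of all such extensions is syzygy closed. The horseshoes exist because
`Ext¹` vanishes between `𝒲` and `𝒢(𝒲)` on either side; the same vanishing, inherited by extensions,
makes the new sequences totally exact. -/
theorem gorenstein_isClosedUnderExtensions : (gorenstein 𝒲).IsClosedUnderExtensions := by
  let 𝒳 : ObjectProperty A := fun E => ∃ S : ShortComplex A, S.ShortExact ∧
    gorenstein 𝒲 S.X₁ ∧ gorenstein 𝒲 S.X₃ ∧ S.X₂ = E
  have hl : ∀ E V, 𝒳 E → 𝒲 V → ExtVanishes.{w} E V := by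
    rintro _ V ⟨S, hS, h₁, h₃, rfl⟩ hV
    exact ExtVanishes.contravariant_X₂ hS (gorenstein_extVanishes_left hO h₁ hV)
      (gorenstein_extVanishes_left hO h₃ hV)
  have hr : ∀ E V, 𝒳 E → 𝒲 V → ExtVanishes.{w} V E := by
    rintro _ V ⟨S, hS, h₁, h₃, rfl⟩ hV
    exact ExtVanishes.covariant_X₂ hS (gorenstein_extVanishes_right hO h₁ hV)
      (gorenstein_extVanishes_right hO h₃ hV)
  have key : IsSyzygyClosed 𝒲 𝒳 := by
    constructor
    · intro E hE
      obtain ⟨S, hS, h₁, h₃, rfl⟩ := id hE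
      obtain ⟨K₁, P₁, i₁, p₁, w₁, hS₁, hK₁⟩ := isSyzygyClosed_gorenstein.exists_left h₁
      obtain ⟨K₃, P₃, i₃, p₃, w₃, hS₃, hK₃⟩ := isSyzygyClosed_gorenstein.exists_left h₃
      obtain ⟨K, hK, ⟨e₁⟩, ⟨e₃⟩, i, p, w, h⟩ := exists_horseshoe hS hS₁.shortExact hS₃.shortExact
        (ExtVanishes.exists_lift hS (gorenstein_extVanishes_right hO h₁ hS₃.mem 1 le_rfl) p₃)
      have hX : 𝒳 K.X₂ := ⟨K, hK, gorenstein_of_iso e₁.symm hK₁, gorenstein_of_iso e₃.symm hK₃, rfl⟩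
      refine ⟨ShortComplex.mk i p w, ⟨⟨h, 𝒲.prop_biprod hS₁.mem hS₃.mem, fun V hV f => ?_⟩,
        fun V hV f => ?_⟩, ⟨Iso.refl _⟩, hX⟩
      · exact ExtVanishes.exists_lift h (hr _ _ hX hV 1 le_rfl) f
      · exact ExtVanishes.exists_extension h (hl _ _ hE hV 1 le_rfl) f
    · intro E hE
      obtain ⟨S, hS, h₁, h₃, rfl⟩ := id hE
      obtain ⟨K₁, P₁, i₁, p₁, w₁, hS₁, hK₁⟩ := isSyzygyClosed_gorenstein.exists_right h₁
      obtain ⟨K₃, P₃, i₃, p₃, w₃, hS₃, hK₃⟩ := isSyzygyClosed_gorenstein.exists_right h₃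
      obtain ⟨K, hK, ⟨e₁⟩, ⟨e₃⟩, i, p, w, h⟩ := exists_cohorseshoe hS hS₁.shortExact hS₃.shortExact
        (ExtVanishes.exists_extension hS (gorenstein_extVanishes_left hO h₃ hS₁.mem 1 le_rfl) i₁)
      have hX : 𝒳 K.X₂ := ⟨K, hK, gorenstein_of_iso e₁.symm hK₁, gorenstein_of_iso e₃.symm hK₃, rfl⟩
      refine ⟨ShortComplex.mk i p w, ⟨⟨h, 𝒲.prop_biprod hS₁.mem hS₃.mem, fun V hV f => ?_⟩,
        fun V hV f => ?_⟩, ⟨Iso.refl _⟩, hX⟩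
      · exact ExtVanishes.exists_lift h (hr _ _ hE hV 1 le_rfl) f
      · exact ExtVanishes.exists_extension h (hl _ _ hX hV 1 le_rfl) f
  exact ⟨fun {S} hS h₁ h₃ => key.le_gorenstein _ ⟨S, hS, h₁, h₃, rfl⟩⟩

lemma syzygyDim_gorenstein_X₂ {n : ℕ} {S : ShortComplex A} (hS : S.ShortExact)
    (h₁ : gorenstein 𝒲 S.X₁) (h₃ : syzygyDim 𝒲 (gorenstein 𝒲) n S.X₃) :
    syzygyDim 𝒲 (gorenstein 𝒲) n S.X₂ := by
  induction n generalizing S with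
  | zero =>
    have := gorenstein_isClosedUnderExtensions hO
    exact (gorenstein 𝒲).prop_X₂_of_shortExact hS h₁ h₃
  | succ n ih =>
    obtain ⟨K₁, P₁, i₁, p₁, w₁, hS₁, hK₁⟩ := isSyzygyClosed_gorenstein.exists_left h₁
    obtain ⟨K₃, P₃, i₃, p₃, w₃, hS₃, hP₃, hK₃⟩ := h₃
    obtain ⟨K, hK, ⟨e₁⟩, ⟨e₃⟩, i, p, w, h⟩ := exists_horseshoe hS hS₁.shortExact hS₃
      (ExtVanishes.exists_lift hS (gorenstein_extVanishes_right hO h₁ hP₃ 1 le_rfl) p₃)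
    exact ⟨_, _, i, p, w, h, 𝒲.prop_biprod hS₁.mem hP₃,
      ih hK (gorenstein_of_iso e₁.symm hK₁) (syzygyDim_of_iso e₃.symm hK₃)⟩

/-- Cover the first term `G` by `P` in `𝒲`. The kernel of `P ⟶ G ⟶ M` is an extension of `L`,
treated by induction, by a Gorenstein object. -/
theorem syzygyDim_of_syzygyDim_gorenstein {n : ℕ} {M : A}
    (h : syzygyDim (gorenstein 𝒲) (gorenstein 𝒲) n M) : syzygyDim 𝒲 (gorenstein 𝒲) n M := by
  induction n generalizing M with
  | zero => exact h
  | succ n ih =>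
    obtain ⟨L, G, j, q, w₂, h₂, hG, hL⟩ := h
    obtain ⟨K, P, i, p, w₁, hS, hK⟩ := isSyzygyClosed_gorenstein.exists_left hG
    obtain ⟨N, hN, ⟨e₁⟩, ⟨e₃⟩, k, w, hk⟩ := exists_kernel_comp hS.shortExact h₂
    exact ⟨_, _, k, p ≫ q, w, hk, hS.mem, syzygyDim_gorenstein_X₂ hO hN
      (gorenstein_of_iso e₁.symm hK) (syzygyDim_of_iso e₃.symm (ih hL))⟩

end Closure

/-! ### Resolutions: splicing, cutting off, length -/

section Resolutions

variable {A : Type u} [Category.{v} A] [Abelian A] {𝒲 𝒳 : ObjectProperty A}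

/-- Degree `0` has no successor and `next` takes the default value `0`, hence the separate case `P 1
0 0`. -/
lemma forall_down_nat {P : ℕ → ℕ → ℕ → Prop} (h₀ : P 1 0 0) (h : ∀ k, P (k + 2) (k + 1) k)
    (i j k : ℕ) (hi : (ComplexShape.down ℕ).prev j = i) (hk : (ComplexShape.down ℕ).next j = k) :
    P i j k := by
  rw [ChainComplex.prev] at hi
  subst hi
  cases j with
  | zero =>
    rw [ChainComplex.next_nat_zero] at hk
    exact hk ▸ h₀
  | succ j =>
    rw [ChainComplex.next_nat_succ] at hk
    exact hk ▸ h j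

lemma acyclic_nat_iff (K : ChainComplex A ℕ) :
    K.Acyclic ↔ Epi (K.d 1 0) ∧
      ∀ k, (ShortComplex.mk (K.d (k + 2) (k + 1)) (K.d (k + 1) k) (by simp)).Exact := by
  have h0 : K.ExactAt 0 ↔ Epi (K.d 1 0) := by
    rw [HomologicalComplex.exactAt_iff' _ 1 0 0 (by simp) (by simp)]
    exact ShortComplex.exact_iff_epi _ (K.shape _ _ (by simp))
  have h1 : ∀ k, K.ExactAt (k + 1) ↔
      (ShortComplex.mk (K.d (k + 2) (k + 1)) (K.d (k + 1) k) (by simp)).Exact := fun k => by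
    rw [HomologicalComplex.exactAt_iff' _ (k + 2) (k + 1) k (by simp) (by simp)]
    rfl
  constructor
  · exact fun h => ⟨h0.1 (h 0), fun k => (h1 k).1 (h (k + 1))⟩
  · rintro ⟨h, h'⟩ (_ | k)
    · exact h0.2 h
    · exact (h1 k).2 (h' k)

lemma homFromExact_nat_iff (K : ChainComplex A ℕ) :
    HomFromExact 𝒳 K ↔ ∀ V : A, 𝒳 V → (∀ f : V ⟶ K.X 0, ∃ g : V ⟶ K.X 1, g ≫ K.d 1 0 = f) ∧
      ∀ k, ∀ f : V ⟶ K.X (k + 1), f ≫ K.d (k + 1) k = 0 →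
        ∃ g : V ⟶ K.X (k + 2), g ≫ K.d (k + 2) (k + 1) = f := by
  rw [homFromExact_iff]
  constructor
  · intro h V hV
    refine ⟨fun f => h V hV 1 0 0 (by simp) (by simp) f ?_,
      fun k f => h V hV (k + 2) (k + 1) k (by simp) (by simp) f⟩
    rw [K.shape _ _ (by simp), comp_zero]
  · intro h V hV
    exact forall_down_nat (fun f _ => (h V hV).1 f) (fun k f => (h V hV).2 k f)

namespace Resolution

variable {K P M : A} {i : K ⟶ P} {p : P ⟶ M} {w : i ≫ p = 0}

lemma epi_ε (X : Resolution 𝒳 M) : Epi X.ε :=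
  ((acyclic_nat_iff _).1 X.exact).1

/-- The resolution of `M` obtained from a short exact sequence `0 ⟶ K ⟶ P ⟶ M ⟶ 0` and a resolution
of `K`. -/
noncomputable def splice (X : Resolution 𝒳 K) (h : (ShortComplex.mk i p w).ShortExact)
    (hP : 𝒳 P) : Resolution 𝒳 M where
  complex := X.complex.augment (X.ε ≫ i) (by rw [← Category.assoc, X.d_comp_ε, zero_comp])
  mem n := match n with
    | 0 => hP
    | n + 1 => X.mem n
  ε := p
  d_comp_ε := show (X.ε ≫ i) ≫ p = 0 by rw [Category.assoc, w, comp_zero]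
  exact := by
    have hX := (acyclic_nat_iff _).1 X.exact
    have := h.mono_f
    have : Epi X.ε := hX.1
    refine (acyclic_nat_iff _).2 ⟨h.epi_g, fun k => ?_⟩
    -- The splice affects exactness only at `P` and at `X_0`, in degrees `1` and `2` of the
    -- augmented complex.
    match k with
    | 0 => exact exact_of_factors _ X.ε i p (𝟙 M) rfl (Category.comp_id p) w h.exact
            hX.1 (inferInstanceAs (Mono (𝟙 M)))
    | 1 => exact exact_of_factors _ (𝟙 _) (X.complex.d 1 0) X.ε i (Category.id_comp _) rfl
            X.d_comp_ε (hX.2 0) inferInstance h.mono_f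
    | k + 2 => exact hX.2 (k + 1)

lemma splice_isProper {X : Resolution 𝒳 K} (hX : X.IsProper)
    (h : (ShortComplex.mk i p w).ShortExact) (hP : 𝒳 P) (hl : Lifts 𝒳 (ShortComplex.mk i p w)) :
    (X.splice h hP).IsProper := by
  have hX' := (homFromExact_nat_iff _).1 hX
  have := h.mono_f
  refine (homFromExact_nat_iff _).2 fun V hV => ⟨hl V hV, fun k => ?_⟩
  match k with
  | 0 =>
    intro f hf
    change V ⟶ P at f
    change f ≫ p = 0 at hf
    change ∃ g : V ⟶ X.complex.X 0, g ≫ X.ε ≫ i = f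
    obtain ⟨x, hx⟩ := h.exact.lift' f hf
    obtain ⟨y, hy⟩ : ∃ y : V ⟶ X.complex.X 0, y ≫ X.ε = x := (hX' V hV).1 x
    exact ⟨y, by rw [reassoc_of% hy, hx]⟩
  | 1 =>
    intro f hf
    change V ⟶ X.complex.X 0 at f
    change f ≫ X.ε ≫ i = 0 at hf
    refine (hX' V hV).2 0 f ?_
    change f ≫ X.ε = 0
    rw [← cancel_mono i, Category.assoc, hf, zero_comp]
  | k + 2 => exact (hX' V hV).2 (k + 1)

/-- Iterated splicing. An object of `𝒳` is itself a splice, of `0 ⟶ 0 ⟶ M ⟶ M ⟶ 0` with a zero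
resolution. -/
lemma exists_bounded (hZ : 𝒳.ContainsZero) [𝒳.IsClosedUnderIsomorphisms] :
    ∀ {n : ℕ} {M : A}, syzygyDim 𝒳 𝒳 n M →
      ∃ (X : Resolution 𝒳 M) (N : ℕ), ∀ k, N ≤ k → IsZero (X.complex.X k) := by
  have h0 : ∀ Z : A, IsZero Z → ∃ (X : Resolution 𝒳 Z) (N : ℕ),
      ∀ k, N ≤ k → IsZero (X.complex.X k) := by
    intro Z hZ'
    obtain ⟨Z₀, hZ₀, hZ₀'⟩ := hZ.exists_zero
    let C : ChainComplex A ℕ := ChainComplex.of (fun _ => Z₀) (fun _ => 0) (fun _ => by simp)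
    exact ⟨⟨C, fun _ => hZ₀', 0, by simp, fun k => HomologicalComplex.ExactAt.of_isZero (by
      cases k
      · exact hZ'
      · exact hZ₀)⟩, 0, fun _ _ => hZ₀⟩
  have hs : ∀ {K P M : A} {i : K ⟶ P} {p : P ⟶ M} {w : i ≫ p = 0},
      (ShortComplex.mk i p w).ShortExact → 𝒳 P →
      (∃ (X : Resolution 𝒳 K) (N : ℕ), ∀ k, N ≤ k → IsZero (X.complex.X k)) →
      ∃ (X : Resolution 𝒳 M) (N : ℕ), ∀ k, N ≤ k → IsZero (X.complex.X k) := by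
    rintro K P M i p w h hP ⟨X, N, hN⟩
    refine ⟨X.splice h hP, N + 1, fun k hk => ?_⟩
    match k with
    | k + 1 => exact hN k (by lia)
  intro n
  induction n with
  | zero =>
    intro M hM
    obtain ⟨Z, hZ₁, -⟩ := hZ.exists_zero
    have : (ShortComplex.mk (0 : Z ⟶ M) (𝟙 M) (by simp)).ShortExact :=
      .mk' ((ShortComplex.exact_iff_mono _ rfl).2 inferInstance)
        (hZ₁.mono _) inferInstance
    exact hs this hM (h0 Z hZ₁)
  | succ n ih =>
    rintro M ⟨K, P, i, p, w, h, hP, hK⟩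
    exact hs h hP (ih hK)

lemma mono_fromOpcycles_augmented (X : Resolution 𝒳 M) (n : ℕ) :
    Mono (X.augmented.fromOpcycles (n + 1) n) :=
  mono_fromOpcycles X.augmented (by simp) (X.exact (n + 1))

/-- The object resolved by `X` is its first syzygy in the augmented complex. -/
noncomputable def opcyclesIso (X : Resolution 𝒳 M) : X.augmented.opcycles 1 ≅ M := by
  have h1 := mono_fromOpcycles_augmented X 0
  have h2 : Epi (X.augmented.fromOpcycles 1 0) := by
    have : Epi (X.augmented.pOpcycles 1 ≫ X.augmented.fromOpcycles 1 0) := by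
      rw [HomologicalComplex.p_fromOpcycles]
      exact X.epi_ε
    exact epi_of_epi (X.augmented.pOpcycles 1) _
  have h3 := isIso_of_mono_of_epi (X.augmented.fromOpcycles 1 0)
  exact @asIso _ _ _ _ (X.augmented.fromOpcycles 1 0) h3

lemma syzygySequence_shortExact (X : Resolution 𝒳 M) (n : ℕ) :
    (syzygySequence X.augmented (n + 1) n).ShortExact :=
  RelTate.syzygySequence_shortExact _ (by simp) (X.exact _)

/-- Augmentation shifts degrees by one: `opcycles (m + 1)` is the `m`-th syzygy, and `M` itself is
the case `m = 0`. -/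
lemma syzygyDim_of_opcycles (X : Resolution 𝒳 M) [𝒳.IsClosedUnderIsomorphisms] {N : ℕ}
    (h : 𝒳 (X.augmented.opcycles (N + 1))) : syzygyDim 𝒳 𝒳 N M := by
  suffices h : ∀ k m, m + k = N → syzygyDim 𝒳 𝒳 k (X.augmented.opcycles (m + 1)) from
    syzygyDim_of_iso X.opcyclesIso (h N 0 (by lia))
  intro k
  induction k with
  | zero =>
    rintro m rfl
    exact h
  | succ k ih =>
    intro m hm
    exact ⟨_, _, _, _, _, X.syzygySequence_shortExact (m + 1), X.mem m, ih (m + 1) (by lia)⟩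

lemma length_lt_top_iff (X : Resolution 𝒳 M) :
    X.length < ⊤ ↔ ∃ N : ℕ, ∀ k, N ≤ k → IsZero (X.complex.X k) := by
  constructor
  · intro h
    obtain ⟨N, hN⟩ := ENat.ne_top_iff_exists.1 h.ne
    refine ⟨N + 1, fun k hk => ?_⟩
    by_contra hk'
    have : (k : ℕ∞) ≤ X.length := le_iSup₂ (f := fun (n : ℕ) (_ : ¬ IsZero (X.complex.X n)) => (n : ℕ∞)) k hk'
    rw [← hN, Nat.cast_le] at this
    lia
  · rintro ⟨N, hN⟩
    refine lt_of_le_of_lt (iSup₂_le (a := (N : ℕ∞)) fun k hk => ?_) (ENat.natCast_lt_top N)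
    rw [Nat.cast_le]
    by_contra h
    exact hk (hN k (by lia))

lemma isProperSyzygy {X : Resolution 𝒳 M} (hX : X.IsProper) (n : ℕ) :
    IsProperSyzygy 𝒳 (syzygySequence X.augmented (n + 2) (n + 1)) where
  shortExact := X.syzygySequence_shortExact (n + 1)
  mem := X.mem n
  lifts V hV f := by
    change V ⟶ X.augmented.opcycles (n + 1) at f
    change ∃ g : V ⟶ X.augmented.X (n + 1), g ≫ X.augmented.pOpcycles (n + 1) = f
    have := mono_fromOpcycles_augmented X n
    have hX' := (homFromExact_iff 𝒳 X.augmented).1 hX V hV (n + 1) n _ (by simp) rfl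
    obtain ⟨g, hg⟩ := hX' (f ≫ X.augmented.fromOpcycles (n + 1) n) (by simp)
    refine ⟨g, ?_⟩
    rw [← cancel_mono (X.augmented.fromOpcycles (n + 1) n), ← hg]
    simp

end Resolution

lemma exists_syzygyDim_of_projDim [𝒳.IsClosedUnderIsomorphisms] {M : A} (h : projDim 𝒳 M < ⊤) :
    ∃ n, syzygyDim 𝒳 𝒳 n M := by
  obtain ⟨X, hX⟩ := iInf_lt_iff.1 h
  obtain ⟨N, hN⟩ := X.length_lt_top_iff.1 hX
  -- The `N`-th syzygy is a quotient of `X_N = 0`, hence isomorphic to `X_N`, which lies in `𝒳`.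
  refine ⟨N, X.syzygyDim_of_opcycles (𝒳.prop_of_iso ?_ (X.mem N))⟩
  have h1 : IsZero (X.augmented.X (N + 1)) := hN N le_rfl
  exact h1.iso (IsZero.of_epi (X.augmented.pOpcycles (N + 1)) h1)

lemma projDim_lt_top [𝒳.IsClosedUnderIsomorphisms] [hZ : 𝒳.ContainsZero] {M : A} {n : ℕ}
    (h : syzygyDim 𝒳 𝒳 n M) : projDim 𝒳 M < ⊤ := by
  obtain ⟨X, hX⟩ := Resolution.exists_bounded hZ h
  exact iInf_lt_iff.2 ⟨X, X.length_lt_top_iff.2 hX⟩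

end Resolutions

/-! ### Existence of Tate resolutions -/

section Existence

variable {A : Type u} [Category.{v} A] [Abelian A] {𝒲 : ObjectProperty A}

/-- The part of a complex in nonnegative degrees. -/
@[simps]
def truncation (T : ChainComplex A ℤ) : ChainComplex A ℕ where
  X n := T.X (n : ℤ)
  d i j := T.d (i : ℤ) (j : ℤ)
  shape i j h := T.shape _ _ fun h' => h (by
    simp only [ComplexShape.down_Rel] at h' ⊢
    exact_mod_cast h')

/-- The complex shifted by one degree. -/
@[simps]
def shiftOne (T : ChainComplex A ℤ) : ChainComplex A ℤ where
  X n := T.X (n - 1)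
  d i j := T.d (i - 1) (j - 1)
  shape i j h := T.shape _ _ fun h' => h (by
    simp only [ComplexShape.down_Rel] at h' ⊢
    lia)

lemma IsTotallyAcyclic.shiftOne {T : ChainComplex A ℤ} (hT : IsTotallyAcyclic 𝒲 T) :
    IsTotallyAcyclic 𝒲 (shiftOne T) where
  mem n := hT.mem (n - 1)
  exact j := by
    rw [HomologicalComplex.exactAt_iff' _ _ j _ rfl rfl]
    exact (HomologicalComplex.exactAt_iff' T _ (j - 1) _ (by simp) (by simp)).1 (hT.exact (j - 1))
  homFrom := by
    rw [homFromExact_iff]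
    intro V hV i j k hi hk
    exact (homFromExact_iff 𝒲 T).1 hT.homFrom V hV (i - 1) (j - 1) (k - 1)
      (by simp at *; lia) (by simp at *; lia)
  homInto := by
    rw [homIntoExact_iff]
    intro V hV i j k hi hk
    exact (homIntoExact_iff 𝒲 T).1 hT.homInto V hV (i - 1) (j - 1) (k - 1)
      (by simp at *; lia) (by simp at *; lia)

/-- The resolution of a zeroth syzygy of a totally acyclic complex by the nonnegative part of this
complex. -/
noncomputable def truncationResolution {T : ChainComplex A ℤ} (hT : IsTotallyAcyclic 𝒲 T) {M : A}
    (e : T.opcycles ((0 : ℕ) : ℤ) ≅ M) : Resolution 𝒲 M where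
  complex := truncation T
  mem n := hT.mem _
  ε := T.pOpcycles ((0 : ℕ) : ℤ) ≫ e.hom
  d_comp_ε := by
    change T.d ((1 : ℕ) : ℤ) ((0 : ℕ) : ℤ) ≫ T.pOpcycles ((0 : ℕ) : ℤ) ≫ e.hom = 0
    rw [T.d_pOpcycles_assoc, zero_comp]
  exact := by
    refine (acyclic_nat_iff _).2 ⟨inferInstanceAs (Epi (T.pOpcycles ((0 : ℕ) : ℤ) ≫ e.hom)),
      fun k => ?_⟩
    match k with
    | 0 =>
      refine exact_of_factors _ (𝟙 _) (T.d ((1 : ℕ) : ℤ) ((0 : ℕ) : ℤ))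
        (T.pOpcycles ((0 : ℕ) : ℤ)) e.hom (Category.id_comp _) rfl
        (T.d_pOpcycles _ _) ?_ inferInstance (inferInstanceAs (Mono e.hom))
      exact ShortComplex.exact_of_g_is_cokernel _ (T.opcyclesIsCokernel _ _ (by simp))
    | k + 1 =>
      exact (HomologicalComplex.exactAt_iff' T ((k + 2 : ℕ) : ℤ) ((k + 1 : ℕ) : ℤ) (k : ℤ)
        (by simp; lia) (by simp)).1 (hT.exact _)

lemma truncationResolution_isProper {T : ChainComplex A ℤ} (hT : IsTotallyAcyclic 𝒲 T) {M : A}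
    (e : T.opcycles ((0 : ℕ) : ℤ) ≅ M) : (truncationResolution hT e).IsProper := by
  refine (homFromExact_nat_iff _).2 fun V hV => ⟨fun f => ?_, fun k => ?_⟩
  · change V ⟶ M at f
    change ∃ g : V ⟶ T.X ((0 : ℕ) : ℤ), g ≫ T.pOpcycles ((0 : ℕ) : ℤ) ≫ e.hom = f
    obtain ⟨g, hg⟩ := (isTotalSyzygy_syzygySequence hT (i := ((1 : ℕ) : ℤ)) (j := ((0 : ℕ) : ℤ))
      (by simp)).lifts V hV (f ≫ e.inv)
    exact ⟨g, by rw [reassoc_of% hg]; simp⟩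
  · match k with
    | 0 =>
      intro f hf
      change V ⟶ T.X ((0 : ℕ) : ℤ) at f
      change f ≫ T.pOpcycles ((0 : ℕ) : ℤ) ≫ e.hom = 0 at hf
      refine (homFromExact_iff 𝒲 T).1 hT.homFrom V hV ((1 : ℕ) : ℤ) ((0 : ℕ) : ℤ) _
        (by simp) rfl f ?_
      have hf' : f ≫ T.pOpcycles ((0 : ℕ) : ℤ) = 0 := by
        rw [← cancel_mono e.hom, Category.assoc, hf, zero_comp]
      rw [← T.p_fromOpcycles, reassoc_of% hf', zero_comp]
    | k + 1 =>
      exact (homFromExact_iff 𝒲 T).1 hT.homFrom V hV ((k + 2 : ℕ) : ℤ) ((k + 1 : ℕ) : ℤ) (k : ℤ)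
        (by simp; lia) (by simp)

/-- The Tate resolution of a syzygy of a totally acyclic complex. -/
noncomputable def TateResolution.ofIsTotallyAcyclic {T : ChainComplex A ℤ}
    (hT : IsTotallyAcyclic 𝒲 T) {M : A} (e : T.opcycles ((0 : ℕ) : ℤ) ≅ M) :
    TateResolution 𝒲 M where
  T := T
  totallyAcyclic := hT
  W := truncationResolution hT e
  proper := truncationResolution_isProper hT e
  α _ := 𝟙 _
  comm _ := (Category.id_comp _).trans (Category.comp_id _).symm
  eventually_isIso := ⟨0, fun _ _ => inferInstanceAs (IsIso (𝟙 _))⟩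

lemma hasTateResolution_of_gorenstein {M : A} (hM : gorenstein 𝒲 M) : HasTateResolution 𝒲 M := by
  obtain ⟨T, hT, ⟨e⟩⟩ := hM
  have e' : T.opcycles 0 ≅ M := ((colimit.isColimit _).coconePointUniqueUpToIso
      (T.opcyclesIsCokernel 1 0 (by simp))).symm ≪≫ e.symm
  exact ⟨⟨TateResolution.ofIsTotallyAcyclic hT e'⟩⟩

/-- Shift `T` by one degree. The only new component is `T_{-1} ⟶ P`, obtained by extending `T_0 ⟶
W_0 ⟶ K ⟶ P` along `T_0 ⟶ T_{-1}`, since `Hom(T, P)` is exact. -/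
lemma HasTateResolution.splice {K P M : A} {i : K ⟶ P} {p : P ⟶ M} {w : i ≫ p = 0}
    (hK : HasTateResolution 𝒲 K) (h : (ShortComplex.mk i p w).ShortExact) (hP : 𝒲 P)
    (hl : Lifts 𝒲 (ShortComplex.mk i p w)) : HasTateResolution 𝒲 M := by
  obtain ⟨τ⟩ := hK.nonempty
  have hT := τ.totallyAcyclic
  -- The two integer degrees are equal but not definitionally so, whence the isomorphisms `XIsoOfEq`
  -- below.
  have hidx : ∀ n : ℕ, (((n + 1 : ℕ) : ℤ) - 1) = (n : ℤ) := fun n => by simp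
  obtain ⟨g, hg⟩ : ∃ g : τ.T.X (((0 : ℕ) : ℤ) - 1) ⟶ P,
      τ.T.d (((0 + 1 : ℕ) : ℤ) - 1) (((0 : ℕ) : ℤ) - 1) ≫ g =
        ((τ.T.XIsoOfEq (hidx 0)).hom ≫ τ.α 0) ≫ τ.W.ε ≫ i := by
    refine (homIntoExact_iff 𝒲 τ.T).1 hT.homInto P hP ((1 : ℕ) : ℤ) _ _ (by simp) (by simp) _ ?_
    have h1 := τ.comm 0
    have h2 := τ.W.d_comp_ε
    simp only [Category.assoc, HomologicalComplex.d_comp_XIsoOfEq_hom_assoc]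
    change τ.T.d ((0 + 1 : ℕ) : ℤ) ((0 : ℕ) : ℤ) ≫ τ.α 0 ≫ τ.W.ε ≫ i = 0
    rw [← reassoc_of% h1, reassoc_of% h2, zero_comp, comp_zero]
  refine ⟨⟨{
    T := shiftOne τ.T
    totallyAcyclic := hT.shiftOne
    W := τ.W.splice h hP
    proper := Resolution.splice_isProper τ.proper h hP hl
    α := fun n => match n with
      | 0 => g
      | n + 1 => (τ.T.XIsoOfEq (hidx n)).hom ≫ τ.α n
    comm := fun n => match n with
      | 0 => hg.symm
      | n + 1 => by
        change ((τ.T.XIsoOfEq (hidx (n + 1))).hom ≫ τ.α (n + 1)) ≫ τ.W.complex.d (n + 1) n =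
          τ.T.d (((n + 1 + 1 : ℕ) : ℤ) - 1) (((n + 1 : ℕ) : ℤ) - 1) ≫
            (τ.T.XIsoOfEq (hidx n)).hom ≫ τ.α n
        rw [Category.assoc, τ.comm, HomologicalComplex.d_comp_XIsoOfEq_hom_assoc,
          HomologicalComplex.XIsoOfEq_hom_comp_d_assoc]
    eventually_isIso := ?_ }⟩⟩
  obtain ⟨N, hN⟩ := τ.eventually_isIso
  refine ⟨N + 1, fun n hn => ?_⟩
  match n with
  | n + 1 =>
    have := hN n (by lia)
    exact inferInstanceAs (IsIso ((τ.T.XIsoOfEq (hidx n)).hom ≫ τ.α n))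

theorem hasTateResolution_of_projDim_gorenstein [HasExt.{w} A] [𝒲.IsClosedUnderExtensions]
    (hO : Orthogonal.{w} 𝒲 𝒲) {M : A} (hM : projDim (gorenstein 𝒲) M < ⊤) :
    HasTateResolution 𝒲 M := by
  obtain ⟨n, hn⟩ := exists_syzygyDim_of_projDim hM
  replace hn := syzygyDim_of_syzygyDim_gorenstein hO hn
  clear hM
  induction n generalizing M with
  | zero => exact hasTateResolution_of_gorenstein hn
  | succ n ih =>
    obtain ⟨K, P, i, p, w, h, hP, hK⟩ := hn
    -- The splice stays proper because `Ext¹(V, K) = 0`, which `K` inherits from the terms and the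
    -- last syzygy of its resolution.
    refine (ih hK).splice h hP fun V hV f => ExtVanishes.exists_lift h ?_ f
    exact syzygyDim_extVanishes (fun X hX => hO V X hV hX)
      (fun X hX => gorenstein_extVanishes_right hO hX hV) hK 1 le_rfl

end Existence

/-! ### Tate cohomology as maps modulo `𝒲`, and the equivalences -/

section Tate

variable {A : Type u} [Category.{v} A] [Abelian A] {𝒲 : ObjectProperty A}

/-- The Tate cohomology group in degree `n` consists of the morphisms from the `n`-th syzygy modulo
those that factor through an object of `𝒲`. -/
lemma isZero_homology_homComplex_iff {T : ChainComplex A ℤ} (hT : IsTotallyAcyclic 𝒲 T) (n : ℤ)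
    (N : A) : IsZero ((homComplex T N).homology n) ↔
      ∀ f : T.opcycles n ⟶ N, FactorsThrough 𝒲 f := by
  rw [← HomologicalComplex.exactAt_iff_isZero_homology,
    homComplex_exactAt_iff T N (i := n + 1) (j := n) (k := n - 1) (by simp) (by simp)]
  constructor
  · intro h f
    obtain ⟨g, hg⟩ := h (T.pOpcycles n ≫ f) (by simp)
    refine ⟨_, hT.mem (n - 1), T.fromOpcycles n (n - 1), g, ?_⟩
    rw [← cancel_epi (T.pOpcycles n), ← hg, T.p_fromOpcycles_assoc]
  · intro h f hf
    -- A cocycle is a map out of `Z_n`. Once it factors through `𝒲`, it extends along `Z_n ⟶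
    -- T_{n-1}`, so it is a coboundary.
    obtain ⟨V, hV, a, b, hab⟩ := h (T.descOpcycles f (n + 1) (by simp) hf)
    obtain ⟨a', ha'⟩ : ∃ a' : T.X (n - 1) ⟶ V, T.fromOpcycles n (n - 1) ≫ a' = a :=
      (isTotalSyzygy_syzygySequence hT (i := n) (j := n - 1) (by simp)).ext V hV a
    refine ⟨a' ≫ b, ?_⟩
    rw [← T.p_fromOpcycles, Category.assoc, reassoc_of% ha', hab, T.p_descOpcycles]

lemma isZero_tateExt_iff (n : ℤ) (M N : A) [HasTateResolution 𝒲 M] :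
    IsZero (tateExt 𝒲 n M N) ↔
      ∀ f : (tateResolution 𝒲 M).T.opcycles n ⟶ N, FactorsThrough 𝒲 f :=
  isZero_homology_homComplex_iff (tateResolution 𝒲 M).totallyAcyclic n N

lemma int_forall_of_succ_iff {P : ℤ → Prop} (h : ∀ n, P n ↔ P (n + 1)) {a : ℤ} (ha : P a) (b : ℤ) :
    P b := by
  have h' : ∀ k : ℕ, ∀ c : ℤ, P c ↔ P (c + k) := by
    intro k
    induction k with
    | zero => simp
    | succ k ih =>
      intro c
      rw [ih c, h (c + k)]
      simp [add_assoc]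
  rcases le_total a b with hab | hab
  · obtain ⟨k, rfl⟩ := Int.le.dest hab
    exact (h' k a).1 ha
  · obtain ⟨k, rfl⟩ := Int.le.dest hab
    exact (h' k b).2 ha

lemma prop_opcycles [𝒲.IsStableUnderRetracts] {T : ChainComplex A ℤ} (hT : IsTotallyAcyclic 𝒲 T)
    {a : ℤ} (ha : 𝒲 (T.opcycles a)) (b : ℤ) : 𝒲 (T.opcycles b) :=
  int_forall_of_succ_iff (P := fun n => 𝒲 (T.opcycles n)) (fun n =>
    ⟨(isTotalSyzygy_syzygySequence hT (i := n + 1) rfl).prop_τ₁,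
      (isTotalSyzygy_syzygySequence hT (i := n + 1) rfl).prop_τ₃⟩) ha b

lemma stableRetract_opcycles {T T' : ChainComplex A ℤ} (hT : IsTotallyAcyclic 𝒲 T)
    (hT' : IsTotallyAcyclic 𝒲 T') {a b : ℤ} (h : StableRetract 𝒲 (T.opcycles a) (T'.opcycles b))
    (k : ℤ) : StableRetract 𝒲 (T.opcycles (a + k)) (T'.opcycles (b + k)) := by
  refine int_forall_of_succ_iff
    (P := fun k => StableRetract 𝒲 (T.opcycles (a + k)) (T'.opcycles (b + k))) (fun n => ?_)
    (a := 0) (by simpa using h) k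
  have h1 := isTotalSyzygy_syzygySequence hT (i := a + (n + 1)) (j := a + n) (by lia)
  have h2 := isTotalSyzygy_syzygySequence hT' (i := b + (n + 1)) (j := b + n) (by lia)
  exact ⟨StableRetract.τ₁ h1.toIsProperSyzygy h2.toIsProperSyzygy, StableRetract.τ₃ h1 h2⟩

namespace Resolution

variable {M : A} (X : Resolution 𝒲 M) (n : ℕ)

/-- The projection of the `n`-th term of a resolution to its image. -/
noncomputable def proj : X.complex.X n ⟶ X.augmented.opcycles (n + 1) :=
  X.augmented.pOpcycles (n + 1)

/-- The inclusion of a syzygy in the `n`-th term of a resolution. -/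
noncomputable def incl : X.augmented.opcycles (n + 2) ⟶ X.complex.X n :=
  X.augmented.fromOpcycles (n + 2) (n + 1)

instance : Epi (X.proj n) := inferInstanceAs (Epi (X.augmented.pOpcycles (n + 1)))

lemma d_proj : X.complex.d (n + 1) n ≫ X.proj n = 0 :=
  X.augmented.d_pOpcycles (n + 2) (n + 1)

lemma proj_incl : X.proj (n + 1) ≫ X.incl n = X.complex.d (n + 1) n :=
  X.augmented.p_fromOpcycles (n + 2) (n + 1)

lemma exists_proj_desc {B : A} (k : X.complex.X n ⟶ B) (hk : X.complex.d (n + 1) n ≫ k = 0) :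
    ∃ θ : X.augmented.opcycles (n + 1) ⟶ B, X.proj n ≫ θ = k :=
  ⟨X.augmented.descOpcycles (i := n + 1) k (n + 2) (by simp) hk,
    X.augmented.p_descOpcycles (i := n + 1) k (n + 2) (by simp) hk⟩

end Resolution

namespace TateResolution

variable {M : A} (τ : TateResolution 𝒲 M)

/-- The morphism induced by the comparison morphism on `n`-th syzygies. -/
noncomputable def syzygyMap (n : ℕ) : τ.T.opcycles (n : ℤ) ⟶ τ.W.augmented.opcycles (n + 1) :=
  τ.T.descOpcycles (τ.α n ≫ τ.W.proj n) ((n + 1 : ℕ) : ℤ) (by simp) (by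
    rw [← reassoc_of% (τ.comm n), τ.W.d_proj, comp_zero])

lemma p_syzygyMap (n : ℕ) : τ.T.pOpcycles (n : ℤ) ≫ τ.syzygyMap n = τ.α n ≫ τ.W.proj n :=
  τ.T.p_descOpcycles ..

/-- The morphism of syzygy sequences induced by the comparison morphism. -/
noncomputable def syzygySequenceMap (n : ℕ) :
    syzygySequence τ.T ((n + 1 : ℕ) : ℤ) (n : ℤ) ⟶
      syzygySequence τ.W.augmented (n + 2) (n + 1) where
  τ₁ := τ.syzygyMap (n + 1)
  τ₂ := τ.α n
  τ₃ := τ.syzygyMap n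
  comm₁₂ := by
    change τ.syzygyMap (n + 1) ≫ τ.W.incl n = τ.T.fromOpcycles _ _ ≫ τ.α n
    rw [← cancel_epi (τ.T.pOpcycles ((n + 1 : ℕ) : ℤ)), reassoc_of% (τ.p_syzygyMap (n + 1)), τ.W.proj_incl,
      τ.T.p_fromOpcycles_assoc, τ.comm]
  comm₂₃ := (τ.p_syzygyMap n).symm

/-- The syzygies are cokernels of `d_{n+1}`, so isomorphisms in degrees `n` and `n + 1` suffice. -/
lemma isIso_syzygyMap {n : ℕ} (h₀ : IsIso (τ.α n)) (h₁ : IsIso (τ.α (n + 1))) :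
    IsIso (τ.syzygyMap n) := by
  obtain ⟨θ, hθ⟩ := τ.W.exists_proj_desc n (inv (τ.α n) ≫ τ.T.pOpcycles (n : ℤ)) (by
    rw [← cancel_epi (τ.α (n + 1)), reassoc_of% (τ.comm n)]
    simp)
  refine ⟨θ, ?_, ?_⟩
  · rw [← cancel_epi (τ.T.pOpcycles (n : ℤ)), reassoc_of% (τ.p_syzygyMap n), hθ]
    simp
  · rw [← cancel_epi (τ.W.proj n), reassoc_of% hθ, p_syzygyMap]
    simp

lemma exists_isIso_syzygyMap : ∃ N : ℕ, ∀ n : ℕ, N ≤ n → IsIso (τ.syzygyMap n) := by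
  obtain ⟨N, hN⟩ := τ.eventually_isIso
  exact ⟨N, fun n hn => τ.isIso_syzygyMap (hN n hn) (hN (n + 1) (by lia))⟩

/-- If the composite of `T_0 ⟶ W_0 ⟶ M` vanishes in Tate cohomology, then the syzygies of `T` lie
in `𝒲`. -/
lemma prop_opcycles_of_factorsThrough [𝒲.IsStableUnderRetracts]
    (h : ∀ f : τ.T.opcycles 0 ⟶ M, FactorsThrough 𝒲 f) (n : ℤ) : 𝒲 (τ.T.opcycles n) := by
  -- Properness of `W` carries the factorization from `Z_0 ⟶ M` to all higher syzygies; where the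
  -- map is invertible, the identity of `Z_N` factors.
  have h0 : ∀ n : ℕ, FactorsThrough 𝒲 (τ.syzygyMap n) := by
    intro n
    induction n with
    | zero =>
      have := (h (τ.syzygyMap 0 ≫ τ.W.opcyclesIso.hom)).comp_right τ.W.opcyclesIso.inv
      simpa using this
    | succ n ih =>
      have := Resolution.isProperSyzygy τ.proper n
      exact factorsThrough_τ₁ (τ.syzygySequenceMap n) (τ.totallyAcyclic.mem _) this.shortExact
        this.lifts ih
  obtain ⟨N, hN⟩ := τ.exists_isIso_syzygyMap
  have := hN N le_rfl
  have h1 := (h0 N).comp_right (inv (τ.syzygyMap N))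
  rw [IsIso.hom_inv_id] at h1
  exact prop_opcycles τ.totallyAcyclic h1.prop_of_id n

lemma projDim_lt_top [𝒲.IsStableUnderRetracts] [𝒲.ContainsZero]
    (h : ∀ n, 𝒲 (τ.T.opcycles n)) : projDim 𝒲 M < ⊤ := by
  obtain ⟨N, hN⟩ := τ.exists_isIso_syzygyMap
  have := hN N le_rfl
  exact RelTate.projDim_lt_top
    (τ.W.syzygyDim_of_opcycles (𝒲.prop_of_iso (asIso (τ.syzygyMap N)) (h N)))

/-- The syzygies of a Tate resolution of a syzygy of a totally acyclic complex `T` agree stably with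
the syzygies of `T`. -/
lemma stableRetract_opcycles [h𝒲 : 𝒲.ContainsZero] {T : ChainComplex A ℤ}
    (hT : IsTotallyAcyclic 𝒲 T) {a : ℤ} (τ : TateResolution 𝒲 (T.opcycles a)) (k : ℤ) :
    StableRetract 𝒲 (T.opcycles (a + k)) (τ.T.opcycles k) := by
  -- `T` is first compared with `W`, in nonnegative degrees, since both give proper syzygies of
  -- `Z_a`.
  have h0 : ∀ m : ℕ, StableRetract 𝒲 (T.opcycles (a + m)) (τ.W.augmented.opcycles (m + 1)) := by
    intro m
    induction m with
    | zero =>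
      simpa using StableRetract.of_iso h𝒲 τ.W.opcyclesIso.symm
    | succ m ih =>
      exact StableRetract.τ₁ (isTotalSyzygy_syzygySequence hT (i := a + ((m + 1 : ℕ) : ℤ))
        (j := a + m) (by push_cast; ring)).toIsProperSyzygy
        (Resolution.isProperSyzygy τ.proper m) ih
  obtain ⟨N, hN⟩ := τ.exists_isIso_syzygyMap
  have := hN N le_rfl
  have h1 : StableRetract 𝒲 (T.opcycles (a + N)) (τ.T.opcycles N) :=
    (h0 N).congr (Iso.refl _) (asIso (τ.syzygyMap N)).symm
  -- In degree `N` the syzygies of `W` are those of `τ.T`; between totally acyclic complexes the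
  -- shift `k - N` may be negative.
  have h2 := RelTate.stableRetract_opcycles hT τ.totallyAcyclic h1 (k - N)
  have e1 : a + N + (k - N) = a + k := by ring
  have e2 : (N : ℤ) + (k - N) = k := by ring
  rwa [e1, e2] at h2

end TateResolution

lemma factorsThrough_of_syzygyDim [HasExt.{w} A] (hO : Orthogonal.{w} 𝒲 𝒲) {X M : A}
    (hX : gorenstein 𝒲 X) : ∀ {n : ℕ} (_ : syzygyDim 𝒲 𝒲 n M) (f : X ⟶ M), FactorsThrough 𝒲 f
  | 0, hM, f => by simpa using (factorsThrough_id (𝒲 := 𝒲) hM).comp_left f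
  | n + 1, ⟨K, P, i, p, w, h, hP, hK⟩, f => by
    have hV := fun V hV => gorenstein_extVanishes_left (V := V) hO hX hV
    obtain ⟨g, hg⟩ := ExtVanishes.exists_lift h (syzygyDim_extVanishes hV hV hK 1 le_rfl) f
    exact ⟨P, hP, g, p, hg⟩

theorem tateExt_tfae [HasExt.{w} A] [𝒲.ContainsZero] [𝒲.IsStableUnderRetracts]
    [𝒲.IsClosedUnderExtensions] (hO : Orthogonal.{w} 𝒲 𝒲) (M : A) [HasTateResolution 𝒲 M] :
    List.TFAE [
      projDim 𝒲 M < ⊤,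
      ∀ (n : ℤ) (X : A) [HasTateResolution 𝒲 X], IsZero (tateExt 𝒲 n X M),
      ∃ n : ℤ, ∀ (X : A) [HasTateResolution 𝒲 X], IsZero (tateExt 𝒲 n X M),
      ∀ (n : ℤ) (N : A), IsZero (tateExt 𝒲 n M N),
      ∃ n : ℤ, ∀ N : A, IsZero (tateExt 𝒲 n M N),
      IsZero (tateExt 𝒲 0 M M)] := by
  let τ := tateResolution 𝒲 M
  tfae_have 1 → 2 := by
    intro h n X _
    obtain ⟨m, hm⟩ := exists_syzygyDim_of_projDim h
    rw [isZero_tateExt_iff]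
    exact factorsThrough_of_syzygyDim hO
      (gorenstein_opcycles (tateResolution 𝒲 X).totallyAcyclic n) hm
  tfae_have 2 → 3 := fun h => ⟨0, fun X _ => h 0 X⟩
  tfae_have 3 → 6 := by
    rintro ⟨n, h⟩
    -- `Z_{-n}` is chosen so that its `n`-th syzygy is `Z_0` modulo `𝒲`.
    have hX := hasTateResolution_of_gorenstein (gorenstein_opcycles τ.totallyAcyclic (-n))
    have h1 := TateResolution.stableRetract_opcycles τ.totallyAcyclic
      (tateResolution 𝒲 (τ.T.opcycles (-n))) n
    rw [neg_add_cancel] at h1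
    rw [isZero_tateExt_iff]
    exact h1.factorsThrough ((isZero_tateExt_iff _ _ _).1 (h _))
  tfae_have 6 → 4 := by
    intro h n N
    rw [isZero_tateExt_iff] at h ⊢
    intro f
    simpa using (factorsThrough_id (τ.prop_opcycles_of_factorsThrough h n)).comp_right f
  tfae_have 4 → 5 := fun h => ⟨0, h 0⟩
  tfae_have 5 → 1 := by
    rintro ⟨n, h⟩
    exact τ.projDim_lt_top (prop_opcycles τ.totallyAcyclic
      (((isZero_tateExt_iff _ _ _).1 (h (τ.T.opcycles n)) (𝟙 _)).prop_of_id))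
  tfae_finish

theorem exists_hasTateResolution_tateExt_tfae [HasExt.{w} A] [𝒲.ContainsZero]
    [𝒲.IsStableUnderRetracts] [𝒲.IsClosedUnderExtensions] (hO : Orthogonal.{w} 𝒲 𝒲) (M : A)
    (hM : projDim (gorenstein 𝒲) M < ⊤) :
    ∃ _ : HasTateResolution 𝒲 M, List.TFAE [
      projDim 𝒲 M < ⊤,
      ∀ (n : ℤ) (X : A) [HasTateResolution 𝒲 X], IsZero (tateExt 𝒲 n X M),
      ∃ n : ℤ, ∀ (X : A) [HasTateResolution 𝒲 X], IsZero (tateExt 𝒲 n X M),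
      ∀ (n : ℤ) (N : A), IsZero (tateExt 𝒲 n M N),
      ∃ n : ℤ, ∀ N : A, IsZero (tateExt 𝒲 n M N),
      IsZero (tateExt 𝒲 0 M M)] :=
  have := hasTateResolution_of_projDim_gorenstein hO hM
  ⟨this, tateExt_tfae hO M⟩

end Tate

/-! ### The isomorphism `P ≅ Hom(C, P ⊗ C)` and retracts of `P ⊗ C` -/

section LinearAlgebra

variable {R : Type u} [CommRing R] {C P : Type u} [AddCommGroup C] [Module R C]
  [AddCommGroup P] [Module R P]

lemma exists_finset_forall_apply_eq_zero {J N : Type u} [AddCommGroup N] [Module R N]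
    [Module.Finite R C] (f : C →ₗ[R] (J →₀ N)) :
    ∃ s : Finset J, ∀ j ∉ s, ∀ c, f c j = 0 := by
  classical
  obtain ⟨t, ht⟩ := Module.Finite.fg_top (R := R) (M := C)
  refine ⟨t.biUnion fun c => (f c).support, fun j hj c => ?_⟩
  have hc : c ∈ Submodule.span R (t : Set C) := ht ▸ Submodule.mem_top
  induction hc using Submodule.span_induction with
  | mem x hx =>
    by_contra h
    exact hj (Finset.mem_biUnion.2 ⟨x, hx, Finsupp.mem_support_iff.2 h⟩)
  | zero => simp
  | add x y _ _ hx hy => simp [hx, hy]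
  | smul a x _ hx => simp [hx]

/-- As `C` is finitely generated, a map from `C` to a direct sum of copies of `C` has finitely many
nonzero components, each a homothety. -/
lemma bijective_mk_finsupp (J : Type u) [Module.Finite R C]
    (h : Function.Bijective (fun r : R => r • (LinearMap.id : C →ₗ[R] C))) :
    Function.Bijective (TensorProduct.mk R (J →₀ R) C) := by
  classical
  let E := TensorProduct.finsuppScalarLeft R C J
  have hE : ∀ p c j, E (p ⊗ₜ c) j = p j • c := fun p c j =>
    TensorProduct.finsuppScalarLeft_apply_tmul_apply p c j
  constructor
  · rw [injective_iff_map_eq_zero]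
    intro p hp
    ext j
    refine h.1 (LinearMap.ext fun c => ?_)
    have : p ⊗ₜ[R] c = 0 := LinearMap.congr_fun hp c
    have h1 := hE p c j
    rw [this, map_zero] at h1
    simpa using h1.symm
  · intro g
    obtain ⟨s, hs⟩ := exists_finset_forall_apply_eq_zero (E.toLinearMap ∘ₗ g)
    have h1 : ∀ j, ∃ r : R, r • (LinearMap.id : C →ₗ[R] C) =
      Finsupp.lapply j ∘ₗ E.toLinearMap ∘ₗ g := fun j => h.2 _
    choose r hr using h1
    have hr' : ∀ j c, r j • c = E (g c) j := fun j c => LinearMap.congr_fun (hr j) c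
    refine ⟨Finsupp.onFinset s r fun j hj => ?_, ?_⟩
    · by_contra hjs
      refine hj (h.1 (LinearMap.ext fun c => ?_))
      have : E (g c) j = 0 := hs j hjs c
      simpa [this] using hr' j c
    · ext c
      refine E.injective (Finsupp.ext fun j => ?_)
      rw [TensorProduct.mk_apply, hE, Finsupp.onFinset_apply, hr']

/-- `P` is a retract of the free module on its underlying set, and bijectivity passes to retracts.
-/
lemma bijective_mk_of_projective [Module.Projective R P] [Module.Finite R C]
    (h : Function.Bijective (fun r : R => r • (LinearMap.id : C →ₗ[R] C))) :
    Function.Bijective (TensorProduct.mk R P C) := by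
  obtain ⟨s, hs⟩ := (Module.projective_def' (R := R) (P := P)).1 inferInstance
  have hF := bijective_mk_finsupp P h
  have hsp : ∀ p, Finsupp.linearCombination R id (s p) = p := LinearMap.congr_fun hs
  constructor
  · rw [injective_iff_map_eq_zero]
    intro p hp
    have h1 : TensorProduct.mk R (P →₀ R) C (s p) = 0 := by
      ext c
      have h2 : p ⊗ₜ[R] c = 0 := LinearMap.congr_fun hp c
      have h3 := congrArg (s.rTensor C) h2
      simpa using h3
    rw [← hsp p, (injective_iff_map_eq_zero _).1 hF.1 _ h1, map_zero]
  · intro g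
    obtain ⟨f, hf⟩ := hF.2 (s.rTensor C ∘ₗ g)
    refine ⟨Finsupp.linearCombination R id f, LinearMap.ext fun c => ?_⟩
    have h1 : f ⊗ₜ[R] c = s.rTensor C (g c) := LinearMap.congr_fun hf c
    have h2 := congrArg ((Finsupp.linearCombination R (id : P → P)).rTensor C) h1
    rw [← LinearMap.comp_apply, ← LinearMap.rTensor_comp, hs, LinearMap.rTensor_id] at h2
    simpa using h2

/-- The idempotent `i ∘ r` of `P ⊗ C` has the form `φ ⊗ C` for a unique endomorphism `φ` of `P`.
Uniqueness makes `φ` idempotent, and `Q` is its image. -/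
lemma exists_projective_of_retract [Module.Projective R P] [Module.Finite R C]
    (h : Function.Bijective (fun r : R => r • (LinearMap.id : C →ₗ[R] C)))
    {M : Type u} [AddCommGroup M] [Module R M] (i : M →ₗ[R] P ⊗[R] C) (r : P ⊗[R] C →ₗ[R] M)
    (hir : r ∘ₗ i = LinearMap.id) :
    ∃ Q : Submodule R P, Module.Projective R Q ∧ Nonempty (M ≃ₗ[R] Q ⊗[R] C) := by
  have hmk := bijective_mk_of_projective (P := P) h
  let e := i ∘ₗ r
  have hri : ∀ m, r (i m) = m := LinearMap.congr_fun hir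
  let coev := LinearEquiv.ofBijective (TensorProduct.mk R P C) hmk
  let φ : P →ₗ[R] P :=
    coev.symm.toLinearMap ∘ₗ (LinearMap.compRight R e) ∘ₗ (TensorProduct.mk R P C)
  have hφ : ∀ p c, φ p ⊗ₜ[R] c = e (p ⊗ₜ c) := fun p c =>
    LinearMap.congr_fun (coev.apply_symm_apply (e ∘ₗ TensorProduct.mk R P C p)) c
  have hφe : φ.rTensor C = e := TensorProduct.ext' fun p c => by simp [hφ]
  have hφφ : ∀ p, φ (φ p) = φ p := fun p => hmk.1 (LinearMap.ext fun c => by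
    simp [hφ, e, hri])
  let ι : LinearMap.range φ →ₗ[R] P := (LinearMap.range φ).subtype
  let π : P →ₗ[R] LinearMap.range φ := φ.rangeRestrict
  have hιπ : ι ∘ₗ π = φ := rfl
  have hπι : π ∘ₗ ι = LinearMap.id := by
    ext ⟨x, p, rfl⟩
    exact hφφ p
  refine ⟨LinearMap.range φ, Module.Projective.of_split ι π hπι,
    ⟨LinearEquiv.ofLinearMap (π.rTensor C ∘ₗ i) (r ∘ₗ ι.rTensor C) ?_ ?_⟩⟩
  · have h1 : (π.rTensor C ∘ₗ i) ∘ₗ r ∘ₗ ι.rTensor C = π.rTensor C ∘ₗ φ.rTensor C ∘ₗ ι.rTensor C := by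
      rw [hφe]; rfl
    have h2 : π ∘ₗ φ ∘ₗ ι = (π ∘ₗ ι) ∘ₗ (π ∘ₗ ι) := LinearMap.ext fun _ => rfl
    rw [h1, ← LinearMap.rTensor_comp, ← LinearMap.rTensor_comp, h2, hπι, LinearMap.id_comp,
      LinearMap.rTensor_id]
  · have h1 : (r ∘ₗ ι.rTensor C) ∘ₗ π.rTensor C ∘ₗ i = r ∘ₗ φ.rTensor C ∘ₗ i := by
      rw [(congrArg (LinearMap.rTensor C) hιπ).symm.trans (LinearMap.rTensor_comp C ι π)]; rfl
    rw [h1, hφe]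
    ext m
    simp [e, hri]

end LinearAlgebra

/-! ### Semidualizing modules: `𝒫_C` satisfies the hypotheses of the general form -/

namespace ExtVanishes

variable {A : Type u} [Category.{v} A] [Abelian A] [HasExt.{w} A] {S : ShortComplex A}
  (hS : S.ShortExact)

include hS

lemma subsingleton_ext_X₃_of_X₁ {X : A} {n : ℕ} (h₁ : Subsingleton (Ext.{w} X S.X₁ (n + 1)))
    (h₂ : Subsingleton (Ext.{w} X S.X₂ n)) : Subsingleton (Ext.{w} X S.X₃ n) := by
  refine subsingleton_of_forall_eq 0 fun x => ?_
  obtain ⟨y, rfl⟩ := Ext.covariant_sequence_exact₃ X hS x rfl (h₁.elim _ _)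
  rw [h₂.elim y 0, Ext.zero_comp]

lemma subsingleton_ext_X₁_of_X₃ {Y : A} {n : ℕ} (h₃ : Subsingleton (Ext.{w} S.X₃ Y (n + 1)))
    (h₂ : Subsingleton (Ext.{w} S.X₂ Y n)) : Subsingleton (Ext.{w} S.X₁ Y n) := by
  refine subsingleton_of_forall_eq 0 fun x => ?_
  obtain ⟨y, rfl⟩ := Ext.contravariant_sequence_exact₁ hS Y x (add_comm _ _) (h₃.elim _ _)
  rw [h₂.elim y 0, Ext.comp_zero]

end ExtVanishes

section Modules

variable {R : Type u} [CommRing R] {C : ModuleCat.{u} R}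

lemma subsingleton_ext_of_projective (P Y : ModuleCat.{u} R) [Projective P] (n : ℕ) :
    Subsingleton (Ext.{u} P Y (n + 1)) :=
  subsingleton_of_forall_eq 0 fun x => x.eq_zero_of_projective

lemma subsingleton_ext_of_injective (X I : ModuleCat.{u} R) [Injective I] (n : ℕ) :
    Subsingleton (Ext.{u} X I (n + 1)) :=
  subsingleton_of_forall_eq 0 fun x => x.eq_zero_of_injective

/-- `Ext` out of a direct sum of copies of `C`. -/
lemma subsingleton_ext_finsupp_left (J : Type u) (n : ℕ) (Y : ModuleCat.{u} R)
    (h : Subsingleton (Ext.{u} C Y (n + 1))) :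
    Subsingleton (Ext.{u} (ModuleCat.of R (J →₀ C)) Y (n + 1)) := by
  induction n generalizing Y with
  | zero =>
    have hS : (ShortComplex.mk (Injective.ι Y) (cokernel.π (Injective.ι Y)) (by simp)).ShortExact :=
      .mk' (ShortComplex.exact_cokernel _) inferInstance inferInstance
    refine ExtVanishes.subsingleton_ext_one_X₁ hS (fun f => ?_)
      (subsingleton_ext_of_injective _ _ 0)
    -- A map out of a direct sum lifts as soon as its components do.
    choose g hg using fun j : J => ExtVanishes.exists_lift hS h
      (ModuleCat.ofHom (f.hom ∘ₗ Finsupp.lsingle j))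
    refine ⟨ModuleCat.ofHom (Finsupp.lsum R fun j => (g j).hom), ?_⟩
    ext j c
    have hgj : (cokernel.π (Injective.ι Y)).hom ((g j).hom c) = f.hom (Finsupp.single j c) :=
      congrArg (fun k => k.hom c) (hg j)
    change (cokernel.π (Injective.ι Y)).hom (Finsupp.lsum R (fun j => (g j).hom)
      (Finsupp.single j c)) = f.hom (Finsupp.single j c)
    rw [Finsupp.lsum_single, hgj]
  | succ n ih =>
    have hS : (ShortComplex.mk (Injective.ι Y) (cokernel.π (Injective.ι Y)) (by simp)).ShortExact :=
      .mk' (ShortComplex.exact_cokernel _) inferInstance inferInstance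
    exact ExtVanishes.subsingleton_ext_X₁ hS (ih _ (ExtVanishes.subsingleton_ext_X₃_of_X₁ hS h
      (subsingleton_ext_of_injective _ _ n))) (subsingleton_ext_of_injective _ _ (n + 1))

/-- `Ext` from a syzygy in a resolution by free modules of finite rank into a direct sum. -/
lemma subsingleton_ext_finsupp_right {D : ModuleCat.{u} R} (X : Resolution (finiteFree R) D)
    (J : Type u) (N : ModuleCat.{u} R) (n k : ℕ)
    (h : Subsingleton (Ext.{u} (X.augmented.opcycles (k + 1)) N (n + 1))) :
    Subsingleton (Ext.{u} (X.augmented.opcycles (k + 1)) (ModuleCat.of R (J →₀ N)) (n + 1)) := by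
  have hproj : ∀ k, Projective (X.augmented.X (k + 1)) := fun k => by
    have : Module.Free R (X.complex.X k) := (X.mem k).1
    exact inferInstanceAs (Projective (X.complex.X k))
  have hS := X.syzygySequence_shortExact (k + 1)
  have hk := hproj k
  induction n generalizing k with
  | zero =>
    refine ExtVanishes.subsingleton_ext_one_X₃ hS (fun f => ?_)
      (subsingleton_ext_of_projective _ _ 0)
    change X.augmented.opcycles (k + 2) ⟶ ModuleCat.of R (J →₀ N) at f
    have : Module.Finite R (X.augmented.X (k + 2)) := (X.mem (k + 1)).2
    have : Module.Finite R (X.augmented.opcycles (k + 2)) :=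
      Module.Finite.of_surjective (X.augmented.pOpcycles (k + 2)).hom
        ((ModuleCat.epi_iff_surjective _).1 inferInstance)
    -- The syzygy is finitely generated, so only finitely many components are nonzero and their
    -- separate extensions can be summed.
    obtain ⟨s, hs⟩ := exists_finset_forall_apply_eq_zero f.hom
    choose g hg using fun j : J => ExtVanishes.exists_extension hS h
      (ModuleCat.ofHom (Finsupp.lapply j ∘ₗ f.hom))
    refine ⟨ModuleCat.ofHom (∑ j ∈ s, Finsupp.lsingle j ∘ₗ (g j).hom), ?_⟩
    ext x j
    have hgj : (g j).hom (X.augmented.fromOpcycles (k + 2) (k + 1) x) = f.hom x j :=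
      congrArg (fun l => l.hom x) (hg j)
    change (∑ j ∈ s, Finsupp.lsingle j ∘ₗ (g j).hom :
      X.augmented.X (k + 1) →ₗ[R] (J →₀ N)) (X.augmented.fromOpcycles (k + 2) (k + 1) x) j =
      f.hom x j
    classical
    simp only [LinearMap.sum_apply, LinearMap.comp_apply, Finsupp.lsingle_apply,
      Finsupp.finsetSum_apply, Finsupp.single_apply, Finset.sum_ite_eq']
    split_ifs with hj
    · exact hgj
    · exact (hs j hj x).symm
  | succ n ih =>
    exact ExtVanishes.subsingleton_ext_X₃ hS (ih (k + 1)
      (ExtVanishes.subsingleton_ext_X₁_of_X₃ hS h (subsingleton_ext_of_projective _ _ n))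
      (X.syzygySequence_shortExact (k + 2)) (hproj (k + 1)))
      (subsingleton_ext_of_projective _ _ (n + 1))

/-- Tensor a splitting of the free cover of `P` with `C`. -/
lemma cProjective_exists_retract {M : ModuleCat.{u} R} (hM : cProjective C M) :
    ∃ J : Type u, Nonempty (Retract M (ModuleCat.of R (J →₀ C))) := by
  obtain ⟨P, hP, ⟨e⟩⟩ := hM
  obtain ⟨s, hs⟩ := Module.projective_def'.1 hP
  classical
  let E := TensorProduct.finsuppScalarLeft R C P
  let q := (Finsupp.linearCombination R (id : P → P)).rTensor C
  refine ⟨P, ⟨{ i := ModuleCat.ofHom (E.toLinearMap ∘ₗ s.rTensor C ∘ₗ e.toLinearMap)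
                r := ModuleCat.ofHom (e.symm.toLinearMap ∘ₗ q ∘ₗ E.symm.toLinearMap)
                retract := ?_ }⟩⟩
  ext m
  have h1 : q (s.rTensor C (e m)) = e m := by
    rw [← LinearMap.comp_apply, ← LinearMap.rTensor_comp, hs, LinearMap.rTensor_id,
      LinearMap.id_apply]
  change e.symm (q (E.symm (E (s.rTensor C (e m))))) = m
  rw [E.symm_apply_apply, h1, e.symm_apply_apply]

namespace IsSemidualizing

variable (hC : IsSemidualizing C)

include hC

lemma finite : Module.Finite R C := by
  obtain ⟨X⟩ := hC.resolution
  have : Module.Finite R (X.complex.X 0) := (X.mem 0).2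
  exact Module.Finite.of_surjective X.ε.hom ((ModuleCat.epi_iff_surjective _).1 X.epi_ε)

lemma extVanishes_finsupp (J : Type u) : ExtVanishes.{u} C (ModuleCat.of R (J →₀ C)) := by
  obtain ⟨X⟩ := hC.resolution
  refine ExtVanishes.of_retract_left (fun n hn => ?_) X.opcyclesIso.symm.retract
  obtain ⟨n, rfl⟩ : ∃ m, n = m + 1 := ⟨n - 1, by lia⟩
  exact subsingleton_ext_finsupp_right X J C n 0
    (ExtVanishes.of_retract_left hC.ext X.opcyclesIso.retract _ hn)

theorem orthogonal : Orthogonal.{u} (cProjective C) (cProjective C) := by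
  intro X Y hX hY
  obtain ⟨J, ⟨r⟩⟩ := cProjective_exists_retract hX
  obtain ⟨J', ⟨r'⟩⟩ := cProjective_exists_retract hY
  refine ExtVanishes.of_retract_left (ExtVanishes.of_retract_right (fun n hn => ?_) r') r
  obtain ⟨n, rfl⟩ : ∃ m, n = m + 1 := ⟨n - 1, by lia⟩
  exact subsingleton_ext_finsupp_left J n _ (hC.extVanishes_finsupp J' _ hn)

lemma cProjective_isStableUnderRetracts : (cProjective C).IsStableUnderRetracts where
  of_retract := by
    rintro X Y r ⟨P, hP, ⟨e⟩⟩
    have := hC.finite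
    obtain ⟨Q, hQ, ⟨e'⟩⟩ := exists_projective_of_retract hC.homothety
      (e.toLinearMap ∘ₗ r.i.hom) (r.r.hom ∘ₗ e.symm.toLinearMap) (by
        ext m
        change r.r.hom (e.symm (e (r.i.hom m))) = m
        rw [e.symm_apply_apply]
        exact congrArg (fun k => k.hom m) r.retract)
    exact ⟨ModuleCat.of R Q, hQ, ⟨e'⟩⟩

lemma cProjective_isClosedUnderExtensions : (cProjective C).IsClosedUnderExtensions where
  prop_X₂_of_shortExact := by
    intro S hS h₁ h₃
    -- The sequence splits by orthogonality, so the middle term is `(P₁ × P₃) ⊗ C`.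
    obtain ⟨s, hs⟩ := ExtVanishes.exists_lift hS (hC.orthogonal _ _ h₃ h₁ 1 le_rfl) (𝟙 S.X₃)
    obtain ⟨P₁, hP₁, ⟨e₁⟩⟩ := h₁
    obtain ⟨P₃, hP₃, ⟨e₃⟩⟩ := h₃
    let e := (ShortComplex.Splitting.ofExactOfSection S hS.exact s hs hS.mono_f).isoBinaryBiproduct ≪≫
      ModuleCat.biprodIsoProd S.X₁ S.X₃
    exact ⟨ModuleCat.of R (P₁ × P₃), inferInstanceAs (Module.Projective R (P₁ × P₃)),
      ⟨e.toLinearEquiv ≪≫ₗ (e₁.prodCongr e₃) ≪≫ₗ (TensorProduct.prodLeft R R P₁ P₃ C).symm⟩⟩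

end IsSemidualizing

lemma cProjective_containsZero : (cProjective C).ContainsZero where
  exists_zero := by
    have : Subsingleton (PUnit.{u + 1} ⊗[R] C) :=
      subsingleton_of_forall_eq 0 fun x => by
        induction x using TensorProduct.induction_on with
        | zero => rfl
        | tmul a c => rw [Subsingleton.elim a 0, TensorProduct.zero_tmul]
        | add x y hx hy => rw [hx, hy, add_zero]
    exact ⟨ModuleCat.of R (PUnit.{u + 1} ⊗[R] C), ModuleCat.isZero_of_subsingleton _,
      ModuleCat.of R PUnit.{u + 1}, inferInstanceAs (Module.Projective R PUnit.{u + 1}),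
      ⟨LinearEquiv.refl R _⟩⟩

end Modules

end RelTate

theorem theoremC :
    -- the result for modules over a commutative ring
    (∀ (R : Type u) [CommRing R] (C : ModuleCat.{u} R), RelTate.IsSemidualizing C →
      ∀ M : ModuleCat.{u} R,
        RelTate.projDim (RelTate.gorenstein (RelTate.cProjective C)) M < ⊤ →
        ∃ _ : RelTate.HasTateResolution (RelTate.cProjective C) M,
          List.TFAE [
            RelTate.projDim (RelTate.cProjective C) M < ⊤,
            ∀ (n : ℤ) (X : ModuleCat.{u} R) [RelTate.HasTateResolution (RelTate.cProjective C) X],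
              IsZero (RelTate.tateExt (RelTate.cProjective C) n X M),
            ∃ n : ℤ, ∀ (X : ModuleCat.{u} R)
              [RelTate.HasTateResolution (RelTate.cProjective C) X],
              IsZero (RelTate.tateExt (RelTate.cProjective C) n X M),
            ∀ (n : ℤ) (N : ModuleCat.{u} R),
              IsZero (RelTate.tateExt (RelTate.cProjective C) n M N),
            ∃ n : ℤ, ∀ N : ModuleCat.{u} R,
              IsZero (RelTate.tateExt (RelTate.cProjective C) n M N),
            IsZero (RelTate.tateExt (RelTate.cProjective C) 0 M M)]) ∧
    -- the general form in an abelian category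
    (∀ (A : Type u) [Category.{v} A] [Abelian A] [HasExt.{w} A] (𝒲 : ObjectProperty A)
      [𝒲.ContainsZero] [𝒲.IsStableUnderRetracts] [𝒲.IsClosedUnderExtensions],
      RelTate.ClosedUnderKernelsOfEpis 𝒲 → RelTate.Orthogonal.{w} 𝒲 𝒲 →
      ∀ M : A, RelTate.projDim (RelTate.gorenstein 𝒲) M < ⊤ →
        ∃ _ : RelTate.HasTateResolution 𝒲 M,
          List.TFAE [
            RelTate.projDim 𝒲 M < ⊤,
            ∀ (n : ℤ) (X : A) [RelTate.HasTateResolution 𝒲 X],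
              IsZero (RelTate.tateExt 𝒲 n X M),
            ∃ n : ℤ, ∀ (X : A) [RelTate.HasTateResolution 𝒲 X],
              IsZero (RelTate.tateExt 𝒲 n X M),
            ∀ (n : ℤ) (N : A), IsZero (RelTate.tateExt 𝒲 n M N),
            ∃ n : ℤ, ∀ N : A, IsZero (RelTate.tateExt 𝒲 n M N),
            IsZero (RelTate.tateExt 𝒲 0 M M)]) := by
  constructor
  · intro R _ C hC M hM
    have := RelTate.cProjective_containsZero (C := C)
    have := hC.cProjective_isStableUnderRetracts
    have := hC.cProjective_isClosedUnderExtensions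
    exact RelTate.exists_hasTateResolution_tateExt_tfae hC.orthogonal M hM
  · intro A _ _ _ 𝒲 _ _ _ _ hO M hM
    exact RelTate.exists_hasTateResolution_tateExt_tfae hO M hM
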